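/- For complex numbers $a,q$ with $|q|<1$ and an integer $n\ge 0$ write $(a;q)_n=\prod_{k=0}^{n-1}(1-aq^k)$, $(a;q)_\infty=\prod_{k=0}^{\infty}(1-aq^k)$ and $(a_1,a_2;q)_\infty=(a_1;q)_\infty(a_2;q)_\infty$. **Theorem 1.3.** Let $q\in\mathbb{C}$ with $|q|<1$. The Nahm sums $$S_1(q)=\sum_{i,j\ge 0}\frac{q^{\frac12 i^2-ij+2j^2-\frac12 i+2j}}{(q^3;q^3)_i(q^3;q^3)_j},\qquad S_2(q)=\sum_{i,j\ge 0}\frac{q^{\frac12 i^2-ij+2j^2+\frac32 i}}{(q^3;q^3)_i(q^3;q^3)_j}$$ converge absolutely, and $$S_1(q)=\frac{(q^4;q^4)_\infty}{(q^3;q^3)_\infty (q^6;q^{12})_\infty}\left(2\frac{(-q^4;q^4)_\infty^2}{(q^{24},q^{96};q^{120})_\infty}+q\frac{(-q^2;q^4)_\infty^2}{(q^{12},-q^{18};-q^{30})_\infty}\right),$$ $$S_2(q)=\frac{(q^4;q^4)_\infty}{(q^3;q^3)_\infty (q^6;q^{12})_\infty}\left(\frac{(-q^2;q^4)_\infty^2}{(-q^6,q^{24};-q^{30})_\infty}+2q^5\frac{(-q^4;q^4)_\infty^2}{(q^{48},q^{72};q^{120})_\infty}\right).$$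 -/

import Mathlib

/-- The finite `q`-shifted factorial `(a; q)_n = ∏_{k=0}^{n-1} (1 - a q^k)`. -/
def qPoch (a q : ℂ) (n : ℕ) : ℂ :=
  ∏ k ∈ Finset.range n, (1 - a * q ^ k)

/-- The infinite `q`-shifted factorial `(a; q)_∞ = ∏_{k=0}^∞ (1 - a q^k)`, used for `|q| < 1`. -/
noncomputable def qPochInf (a q : ℂ) : ℂ :=
  ∏' k : ℕ, (1 - a * q ^ k)

/-- The product defining `(a; q)_∞` converges when `|q| < 1`. -/
theorem multipliable_qPochInf (a q : ℂ) (hq : ‖q‖ < 1) :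
    Multipliable fun k : ℕ => 1 - a * q ^ k := by
  have h : Summable fun k : ℕ => ‖-(a * q ^ k)‖ := by
    simpa [norm_mul, norm_pow] using
      (summable_geometric_of_lt_one (norm_nonneg q) hq).mul_left ‖a‖
  simpa [sub_eq_add_neg] using multipliable_one_add_of_summable h

/-- The product defining `(a₁, a₂; q)_∞ = (a₁; q)_∞ (a₂; q)_∞`. -/
noncomputable def qPochInf₂ (a₁ a₂ q : ℂ) : ℂ :=
  qPochInf a₁ q * qPochInf a₂ q

/-- The `(i, j)` term of `S₁(q)`. The exponent `i²/2 - ij + 2j² - i/2 + 2j` is written as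
`i(i-1)/2 - ij + 2j² + 2j`; the division by two is exact, and the value is a nonnegative
integer. -/
noncomputable def nahmTerm₁ (q : ℂ) (i j : ℕ) : ℂ :=
  q ^ ((i : ℤ) * (i - 1) / 2 - i * j + 2 * (j : ℤ) ^ 2 + 2 * j) /
    (qPoch (q ^ 3) (q ^ 3) i * qPoch (q ^ 3) (q ^ 3) j)

/-- The `(i, j)` term of `S₂(q)`. The exponent `i²/2 - ij + 2j² + 3i/2` is written as
`i(i+3)/2 - ij + 2j²`; the division by two is exact, and the value is a nonnegative integer. -/
noncomputable def nahmTerm₂ (q : ℂ) (i j : ℕ) : ℂ :=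
  q ^ ((i : ℤ) * (i + 3) / 2 - i * j + 2 * (j : ℤ) ^ 2) /
    (qPoch (q ^ 3) (q ^ 3) i * qPoch (q ^ 3) (q ^ 3) j)

/-- The Nahm sum `S₁(q)`, a double series over all `i, j ≥ 0`. -/
noncomputable def nahmS₁ (q : ℂ) : ℂ := ∑' p : ℕ × ℕ, nahmTerm₁ q p.1 p.2

/-- The Nahm sum `S₂(q)`, a double series over all `i, j ≥ 0`. -/
noncomputable def nahmS₂ (q : ℂ) : ℂ := ∑' p : ℕ × ℕ, nahmTerm₂ q p.1 p.2

/-! Write T(l) = l(l - 1)/2 and Q = q³. Both exponents have the form s(i - j) + T(i - j) + 3T(j +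
1), with s = 0 for S₁ and s = 2 for S₂, so the j-part is a power of Q, the base of the denominators.
The factor 1/(Q;Q)_i is expanded by 1/(z;Q)_∞ = (-z;Q)_∞ / (z²;Q²)_∞ (`sum_antidiagonal_evenCoeff`),
with i = 2k + r. The new factor Q^T(r)/(Q;Q)_r pairs with Q^T(j+1)/(Q;Q)_j, and Cauchy's identity
(`tsum_cauchy`, through `hasSum_diagonal`) sums each diagonal r - j = l to Q^T(l)/(Q;Q)_∞. What is
left in l is a theta series of base q⁴. Centring it takes a shift by about k/2, so even and odd k
give different theta functions.

The sums over even and odd k are then the two halves of the Rogers series ∑ t^(k² + sk)/(t⁴;t⁴)_k at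
t⁴ = q⁶. Multiplication by (-t²;t²)_∞ turns that series into a Rogers–Ramanujan series in t
(`qPochInf_mul_rogersSum_eq`), hence its product with a function of t⁴ is a single theta function.
Splitting this theta function by the parity of its index separates even from odd powers of t
(`jacobiProd_split`, `rogers_parts`) and evaluates both halves.

The Rogers–Ramanujan identities come from a recurrence shared with a one-sided theta series
(`qPochInf_mul_rrSum`); the Jacobi triple product comes from Euler's expansion and the same diagonal
summation. -/

open Filter Topology

/-! ### Finite and infinite q-Pochhammer symbols -/

theorem qPoch_zero (a q : ℂ) : qPoch a q 0 = 1 := by simp [qPoch]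

theorem qPoch_succ (a q : ℂ) (n : ℕ) : qPoch a q (n + 1) = qPoch a q n * (1 - a * q ^ n) := by
  simp [qPoch, Finset.prod_range_succ]

theorem tendsto_qPoch (a : ℂ) {q : ℂ} (hq : ‖q‖ < 1) :
    Tendsto (qPoch a q) atTop (𝓝 (qPochInf a q)) :=
  (multipliable_qPochInf a q hq).hasProd.tendsto_prod_nat

theorem qPoch_add (a q : ℂ) (m n : ℕ) :
    qPoch a q (m + n) = qPoch a q m * qPoch (a * q ^ m) q n := by
  simp [qPoch, Finset.prod_range_add, pow_add, mul_assoc]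

theorem qPochInf_eq_qPoch_mul (a : ℂ) {q : ℂ} (hq : ‖q‖ < 1) (m : ℕ) :
    qPochInf a q = qPoch a q m * qPochInf (a * q ^ m) q := by
  have h₁ := (tendsto_qPoch a hq).comp (tendsto_add_atTop_nat m)
  have h₂ := (tendsto_qPoch (a * q ^ m) hq).const_mul (qPoch a q m)
  refine tendsto_nhds_unique h₁ (h₂.congr fun n => ?_)
  simp only [Function.comp, add_comm n m, qPoch_add]

theorem qPochInf_eq_one_sub_mul (a : ℂ) {q : ℂ} (hq : ‖q‖ < 1) :
    qPochInf a q = (1 - a) * qPochInf (a * q) q := by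
  have := qPochInf_eq_qPoch_mul a hq 1
  simpa [qPoch] using this

theorem norm_pow_lt_one {q : ℂ} (hq : ‖q‖ < 1) {m : ℕ} (hm : m ≠ 0) : ‖q ^ m‖ < 1 := by
  rw [norm_pow]; exact pow_lt_one₀ (norm_nonneg q) hq hm

theorem one_sub_ne_zero_of_norm {a : ℂ} (ha : ‖a‖ < 1) : 1 - a ≠ 0 := by
  intro h
  rw [← sub_eq_zero.mp h] at ha
  simp at ha

theorem norm_mul_pow_lt_one {a q : ℂ} (ha : ‖a‖ < 1) (hq : ‖q‖ < 1) (k : ℕ) :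
    ‖a * q ^ k‖ < 1 := by
  rw [norm_mul, norm_pow]
  exact mul_lt_one_of_nonneg_of_lt_one_left (norm_nonneg a) ha (pow_le_one₀ (norm_nonneg q) hq.le)

theorem qPochInf_ne_zero {a q : ℂ} (ha : ‖a‖ < 1) (hq : ‖q‖ < 1) : qPochInf a q ≠ 0 := by
  have h : Summable fun k : ℕ => ‖-(a * q ^ k)‖ := by
    simpa [norm_mul, norm_pow] using
      (summable_geometric_of_lt_one (norm_nonneg q) hq).mul_left ‖a‖
  have := tprod_one_add_ne_zero_of_summable (f := fun k : ℕ => -(a * q ^ k)) (fun k => by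
    simpa [sub_eq_add_neg] using one_sub_ne_zero_of_norm (norm_mul_pow_lt_one ha hq k)) h
  simpa [qPochInf, sub_eq_add_neg] using this

theorem qPoch_ne_zero {a q : ℂ} (ha : ‖a‖ < 1) (hq : ‖q‖ < 1) (n : ℕ) : qPoch a q n ≠ 0 :=
  Finset.prod_ne_zero_iff.mpr fun k _ => one_sub_ne_zero_of_norm (norm_mul_pow_lt_one ha hq k)

theorem exists_norm_qPoch_le (a : ℂ) {q : ℂ} (hq : ‖q‖ < 1) : ∃ C, ∀ n, ‖qPoch a q n‖ ≤ C := by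
  obtain ⟨C, hC⟩ := (Metric.isBounded_range_of_tendsto _ (tendsto_qPoch a hq)).exists_norm_le
  exact ⟨C, fun n => hC _ ⟨n, rfl⟩⟩

theorem exists_norm_inv_qPoch_le {a q : ℂ} (ha : ‖a‖ < 1) (hq : ‖q‖ < 1) :
    ∃ C, ∀ n, ‖(qPoch a q n)⁻¹‖ ≤ C := by
  obtain ⟨C, hC⟩ := (Metric.isBounded_range_of_tendsto _
    ((tendsto_qPoch a hq).inv₀ (qPochInf_ne_zero ha hq))).exists_norm_le
  exact ⟨C, fun n => hC _ ⟨n, rfl⟩⟩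

theorem qPoch_mul (a q : ℂ) (m n : ℕ) :
    qPoch a q (m * n) = ∏ i ∈ Finset.range m, qPoch (a * q ^ i) (q ^ m) n := by
  induction n with
  | zero => simp [qPoch]
  | succ n ih =>
    rw [Nat.mul_succ, qPoch_add, ih]
    simp only [qPoch_succ, Finset.prod_mul_distrib]
    congr 1
    refine Finset.prod_congr rfl fun i _ => ?_
    ring

theorem qPochInf_eq_prod (a : ℂ) {q : ℂ} (hq : ‖q‖ < 1) {m : ℕ} (hm : m ≠ 0) :
    qPochInf a q = ∏ i ∈ Finset.range m, qPochInf (a * q ^ i) (q ^ m) := by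
  have h₁ := (tendsto_qPoch a hq).comp (tendsto_id.const_mul_atTop' (Nat.pos_of_ne_zero hm))
  have h₂ := tendsto_finsetProd (Finset.range m) fun i _ =>
    tendsto_qPoch (a * q ^ i) (norm_pow_lt_one hq hm)
  refine tendsto_nhds_unique h₁ (h₂.congr fun n => ?_)
  simp only [Function.comp, id, qPoch_mul]

theorem qPochInf_mul_neg (a : ℂ) {q : ℂ} (hq : ‖q‖ < 1) :
    qPochInf a q * qPochInf (-a) q = qPochInf (a ^ 2) (q ^ 2) := by
  rw [qPochInf, qPochInf, qPochInf,
    ← (multipliable_qPochInf a q hq).tprod_mul (multipliable_qPochInf (-a) q hq)]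
  congr 1 with k
  ring

/-! ### Domination, limits and shifts of q-series -/

theorem norm_pow_mul_le {q u : ℂ} (hq : ‖q‖ < 1) {C : ℝ} (hu : ‖u‖ ≤ C) {n e : ℕ} (h : n ≤ e) :
    ‖q ^ e * u‖ ≤ C * ‖q‖ ^ n := by
  rw [norm_mul, norm_pow, mul_comm]
  exact mul_le_mul hu (pow_le_pow_of_le_one (norm_nonneg q) hq.le h) (by positivity)
    ((norm_nonneg u).trans hu)

theorem summable_pow_mul {q : ℂ} (hq : ‖q‖ < 1) {e : ℕ → ℕ} (he : ∀ n, n ≤ e n) {u : ℕ → ℂ}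
    {C : ℝ} (hu : ∀ n, ‖u n‖ ≤ C) : Summable fun n => q ^ e n * u n :=
  .of_norm_bounded ((summable_geometric_of_lt_one (norm_nonneg q) hq).mul_left C)
    fun n => norm_pow_mul_le hq (hu n) (he n)

theorem tendsto_pow_norm {q : ℂ} (hq : ‖q‖ < 1) : Tendsto (fun m : ℕ => ‖q‖ ^ m) atTop (𝓝 0) :=
  tendsto_pow_atTop_nhds_zero_of_lt_one (norm_nonneg q) hq

/-- If the exponents `e m n` with `n ≠ 0` tend to infinity with `m`, only the term `n = 0` of
`∑ q ^ e m n * u m n` survives in the limit. -/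
theorem tendsto_tsum_pow_mul {q : ℂ} (hq : ‖q‖ < 1) {e : ℕ → ℕ → ℕ} {u : ℕ → ℕ → ℂ} {C : ℝ} {L : ℂ}
    (he : ∀ m n, n ≤ e m n) (he' : ∀ m n, n ≠ 0 → m ≤ e m n) (hu : ∀ m n, ‖u m n‖ ≤ C)
    (h0 : Tendsto (fun m => q ^ e m 0 * u m 0) atTop (𝓝 L)) :
    Tendsto (fun m => ∑' n, q ^ e m n * u m n) atTop (𝓝 L) := by
  have key := tendsto_tsum_of_dominated_convergence (𝓕 := atTop)
    (f := fun m n => q ^ e m n * u m n) (g := fun n => if n = 0 then L else 0)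
    ((summable_geometric_of_lt_one (norm_nonneg q) hq).mul_left C) (fun n => ?_)
    (Eventually.of_forall fun m n => norm_pow_mul_le hq (hu m n) (he m n))
  · simpa using key
  · by_cases hn : n = 0
    · simpa [hn] using h0
    · simp only [hn, if_false]
      refine squeeze_zero_norm (fun m => norm_pow_mul_le hq (hu m n) (he' m n hn)) ?_
      simpa using (tendsto_pow_norm hq).const_mul C

/-- The common mechanism behind the recurrences: a factor 1 - q^n kills the first term of one half,
which is then reindexed against the other. -/
theorem tsum_add_eq_tsum_of_shift {a b c : ℕ → ℂ} (ha : Summable a) (hb : Summable b)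
    (h0 : a 0 = 0) (h : ∀ n, a (n + 1) + b n = c n) : ∑' n, (a n + b n) = ∑' n, c n := by
  rw [ha.tsum_add hb, ha.tsum_eq_zero_add, h0, zero_add,
    ← ((summable_nat_add_iff 1).mpr ha).tsum_add hb]
  exact tsum_congr h

/-! ### The Rogers–Ramanujan recurrence -/

/-- Going back from infinity costs at most the convergent product ∏ (1 + |q|^(k+1)), so a solution
with limit 0 vanishes. This is the uniqueness used in `qPochInf_mul_rrSum`. -/
theorem eq_zero_of_rogersRamanujan_rec {q : ℂ} (hq : ‖q‖ < 1) {d : ℕ → ℂ}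
    (hrec : ∀ m, d m = d (m + 1) + q ^ (m + 1) * d (m + 2)) (hd : Tendsto d atTop (𝓝 0))
    (m : ℕ) : d m = 0 := by
  -- The maximum over two neighbours turns the second-order recurrence into a first-order
  -- inequality.
  set B : ℕ → ℝ := fun k => max ‖d k‖ ‖d (k + 1)‖ with hB
  have hstep : ∀ k, B k ≤ (1 + ‖q‖ ^ (k + 1)) * B (k + 1) := by
    intro k
    have h1 : ‖d (k + 1)‖ ≤ B (k + 1) := le_max_left _ _
    have h2 : ‖d (k + 2)‖ ≤ B (k + 1) := le_max_right _ _
    have hp : 0 ≤ ‖q‖ ^ (k + 1) := by positivity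
    refine max_le ?_ ?_
    · rw [hrec k]
      refine (norm_add_le _ _).trans ?_
      rw [norm_mul, norm_pow, add_mul, one_mul]
      gcongr
    · nlinarith [norm_nonneg (d (k + 1))]
  have hsum : Summable fun k : ℕ => ‖‖q‖ ^ (m + k + 1)‖ := by
    simp only [pow_add]
    exact (((summable_geometric_of_lt_one (norm_nonneg q) hq).mul_left _).mul_right _).norm
  have hprod := (multipliable_one_add_of_summable hsum).hasProd.tendsto_prod_nat
  have hbound : ∀ n, B m ≤ (∏ k ∈ Finset.range n, (1 + ‖q‖ ^ (m + k + 1))) * B (m + n) := by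
    intro n
    induction n with
    | zero => simp
    | succ n ih =>
      refine ih.trans ?_
      rw [Finset.prod_range_succ, mul_assoc]
      exact mul_le_mul_of_nonneg_left (hstep (m + n)) (Finset.prod_nonneg fun k _ => by positivity)
  have hBlim : Tendsto (fun n => B (m + n)) atTop (𝓝 0) := by
    have h := (hd.norm.max (hd.norm.comp (tendsto_add_atTop_nat 1)))
    simp only [norm_zero, max_self] at h
    exact (h.comp (tendsto_add_atTop_nat m)).congr fun n => by simp [hB, add_comm]
  have := ge_of_tendsto' (hprod.mul hBlim) hbound
  rw [mul_zero] at this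
  exact norm_le_zero_iff.mp ((le_max_left _ _).trans this)

/-- The Rogers–Ramanujan series `∑ q ^ (n ^ 2 + m * n) / (q; q)_n`. -/
noncomputable def rrSum (q : ℂ) (m : ℕ) : ℂ := ∑' n : ℕ, q ^ (n ^ 2 + m * n) * (qPoch q q n)⁻¹

theorem rrSum_rec {q : ℂ} (hq : ‖q‖ < 1) (m : ℕ) :
    rrSum q m = rrSum q (m + 1) + q ^ (m + 1) * rrSum q (m + 2) := by
  obtain ⟨C, hC⟩ := exists_norm_inv_qPoch_le hq hq
  have hs : ∀ m, Summable fun n : ℕ => q ^ (n ^ 2 + m * n) * (qPoch q q n)⁻¹ := fun m =>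
    summable_pow_mul hq (fun n => by nlinarith) hC
  -- The difference of the terms for m and m + 1 carries 1 - q^n, which cancels the last factor of
  -- (q;q)_n.
  have := tsum_add_eq_tsum_of_shift ((hs m).sub (hs (m + 1))) (hs (m + 1)) (by simp)
    (c := fun n => q ^ (n ^ 2 + (m + 1) * n) * (qPoch q q n)⁻¹ +
      q ^ (m + 1) * (q ^ (n ^ 2 + (m + 2) * n) * (qPoch q q n)⁻¹)) (fun n => ?_)
  · simp only [sub_add_cancel] at this
    rw [rrSum, this, (hs (m + 1)).tsum_add ((hs (m + 2)).mul_left _), tsum_mul_left]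
    rfl
  · have h1 := qPoch_ne_zero hq hq n
    have h2 : 1 - q * q ^ n ≠ 0 := one_sub_ne_zero_of_norm (norm_mul_pow_lt_one hq hq n)
    rw [qPoch_succ]
    field_simp
    ring

theorem tendsto_rrSum {q : ℂ} (hq : ‖q‖ < 1) : Tendsto (rrSum q) atTop (𝓝 1) := by
  obtain ⟨C, hC⟩ := exists_norm_inv_qPoch_le hq hq
  refine tendsto_tsum_pow_mul hq (e := fun m n => n ^ 2 + m * n) (fun m n => by nlinarith)
    (fun m n hn => ?_) (fun _ n => hC n) (by simp [qPoch_zero])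
  have := Nat.pos_of_ne_zero hn
  nlinarith

theorem five_mul_half_succ (n : ℕ) :
    (n + 1) * (5 * (n + 1) + 1) / 2 = n * (5 * n + 1) / 2 + (5 * n + 3) := by
  rw [← Nat.add_mul_div_left _ _ two_pos]
  congr 1
  ring

theorem le_five_mul_half (n : ℕ) : n ≤ n * (5 * n + 1) / 2 := by
  induction n with
  | zero => simp
  | succ n ih => rw [five_mul_half_succ]; omega

/-- The one-sided theta series that equals `(q; q)_∞ * rrSum q m`. -/
noncomputable def rrTheta (q : ℂ) (m : ℕ) : ℂ :=
  ∑' n : ℕ, q ^ (2 * m * n + n * (5 * n + 1) / 2) *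
    ((-1) ^ n * (1 - q ^ (2 * m + 4 * n + 2)) * (qPoch q q (n + m) * (qPoch q q n)⁻¹))

theorem norm_one_sub_pow_le {q : ℂ} (hq : ‖q‖ < 1) (k : ℕ) : ‖1 - q ^ k‖ ≤ 2 := by
  refine (norm_sub_le _ _).trans ?_
  rw [norm_one, norm_pow]
  linarith [pow_le_one₀ (n := k) (norm_nonneg q) hq.le]

theorem exists_norm_rrTheta_coeff_le {q : ℂ} (hq : ‖q‖ < 1) : ∃ C, ∀ i j k n : ℕ,
    ‖(-1) ^ n * (1 - q ^ i) * (qPoch q q j * (qPoch q q k)⁻¹)‖ ≤ C := by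
  obtain ⟨C₁, h₁⟩ := exists_norm_qPoch_le q hq
  obtain ⟨C₂, h₂⟩ := exists_norm_inv_qPoch_le hq hq
  refine ⟨2 * (C₁ * C₂), fun i j k n => ?_⟩
  have h0 : 0 ≤ C₁ := (norm_nonneg _).trans (h₁ 0)
  have h0' : 0 ≤ C₂ := (norm_nonneg _).trans (h₂ 0)
  simp only [norm_mul, norm_pow, norm_neg, norm_one, one_pow, one_mul]
  exact mul_le_mul (norm_one_sub_pow_le hq i) (mul_le_mul (h₁ j) (h₂ k) (norm_nonneg _) h0)
    (by positivity) (by positivity)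

/-- Follows from 1 - q^(2n+m+1) = (1 - q^n) + q^n (1 - q^(n+m+1)) by shifting the first part. The
Pochhammer quotient becomes that of `rrTheta q m`, so the two series can be compared term by term.
-/
theorem rrTheta_succ {q : ℂ} (hq : ‖q‖ < 1) (m : ℕ) :
    rrTheta q (m + 1) = ∑' n : ℕ, q ^ (2 * m * n + n * (5 * n + 1) / 2 + n) *
      ((-1) ^ n * (1 - q ^ (2 * n + m + 1)) * (qPoch q q (n + m) * (qPoch q q n)⁻¹)) := by
  obtain ⟨C, hC⟩ := exists_norm_rrTheta_coeff_le hq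
  have ha := summable_pow_mul hq (e := fun n => 2 * m * n + n * (5 * n + 1) / 2 + n)
    (fun n => by omega) (fun n => hC n (n + m) n n)
  have hb := summable_pow_mul hq (e := fun n => 2 * m * n + n * (5 * n + 1) / 2 + n + n)
    (fun n => by omega) (fun n => hC (n + m + 1) (n + m) n n)
  rw [rrTheta, ← tsum_add_eq_tsum_of_shift ha hb (by simp) (fun n => ?_)]
  · refine tsum_congr fun n => ?_
    ring
  · have h1 := qPoch_ne_zero hq hq n
    have h2 : 1 - q * q ^ n ≠ 0 := one_sub_ne_zero_of_norm (norm_mul_pow_lt_one hq hq n)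
    rw [five_mul_half_succ, show n + 1 + m = n + m + 1 by ring,
      show n + (m + 1) = n + m + 1 by ring, qPoch_succ _ _ n, qPoch_succ _ _ (n + m)]
    generalize n * (5 * n + 1) / 2 = t
    field_simp
    ring

/-- Subtracting the `rrTheta_succ` form from `rrTheta q m` leaves (1 - q^n) + q^(3n+m+1) (1 -
q^(n+m+1)); shifting the first part gives the `rrTheta_succ` form of index m + 2. -/
theorem rrTheta_rec {q : ℂ} (hq : ‖q‖ < 1) (m : ℕ) :
    rrTheta q m = rrTheta q (m + 1) + q ^ (m + 1) * rrTheta q (m + 2) := by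
  obtain ⟨C, hC⟩ := exists_norm_rrTheta_coeff_le hq
  have ha := summable_pow_mul hq (e := fun n => 2 * m * n + n * (5 * n + 1) / 2)
    (fun n => (le_five_mul_half n).trans (by omega)) (fun n => hC n (n + m) n n)
  have hb := summable_pow_mul hq (e := fun n => 2 * m * n + n * (5 * n + 1) / 2 + 3 * n + m + 1)
    (fun n => by omega) (fun n => hC (n + m + 1) (n + m) n n)
  have hc := summable_pow_mul hq (e := fun n => 2 * m * n + n * (5 * n + 1) / 2 + n)
    (fun n => by omega) (fun n => hC (2 * n + m + 1) (n + m) n n)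
  have key := tsum_add_eq_tsum_of_shift ha hb (by simp) (c := fun n => q ^ (m + 1) *
    (q ^ (2 * (m + 1) * n + n * (5 * n + 1) / 2 + n) * ((-1) ^ n * (1 - q ^ (2 * n + (m + 1) + 1)) *
      (qPoch q q (n + (m + 1)) * (qPoch q q n)⁻¹)))) (fun n => ?_)
  · rw [rrTheta_succ hq m, rrTheta_succ hq (m + 1), ← tsum_mul_left, ← key,
      ← hc.tsum_add (ha.add hb), rrTheta]
    refine tsum_congr fun n => ?_
    ring
  · have h1 := qPoch_ne_zero hq hq n
    have h2 : 1 - q * q ^ n ≠ 0 := one_sub_ne_zero_of_norm (norm_mul_pow_lt_one hq hq n)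
    rw [five_mul_half_succ, show n + 1 + m = n + m + 1 by ring,
      show n + (m + 1) = n + m + 1 by ring, qPoch_succ _ _ n, qPoch_succ _ _ (n + m)]
    generalize n * (5 * n + 1) / 2 = t
    field_simp
    ring

theorem tendsto_rrTheta {q : ℂ} (hq : ‖q‖ < 1) :
    Tendsto (rrTheta q) atTop (𝓝 (qPochInf q q)) := by
  obtain ⟨C, hC⟩ := exists_norm_rrTheta_coeff_le hq
  refine tendsto_tsum_pow_mul hq (e := fun m n => 2 * m * n + n * (5 * n + 1) / 2)
    (fun m n => (le_five_mul_half n).trans (by omega)) (fun m n hn => ?_)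
    (fun m n => hC (2 * m + 4 * n + 2) (n + m) n n) ?_
  · have := Nat.pos_of_ne_zero hn
    have := Nat.zero_le (n * (5 * n + 1) / 2)
    nlinarith
  · have h1 : Tendsto (fun m : ℕ => q ^ (2 * m + 2)) atTop (𝓝 0) :=
      (tendsto_pow_atTop_nhds_zero_of_norm_lt_one hq).comp
        (tendsto_atTop_mono (fun m => by omega : ∀ m : ℕ, m ≤ 2 * m + 2) tendsto_id)
    simpa [qPoch_zero] using (h1.const_sub 1).mul (tendsto_qPoch q hq)

/-- Both sides satisfy the same recurrence and tend to (q;q)_∞ as m grows. -/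
theorem qPochInf_mul_rrSum {q : ℂ} (hq : ‖q‖ < 1) (m : ℕ) :
    qPochInf q q * rrSum q m = rrTheta q m := by
  refine sub_eq_zero.mp (eq_zero_of_rogersRamanujan_rec hq
    (d := fun m => qPochInf q q * rrSum q m - rrTheta q m) (fun m => ?_) ?_ m)
  · rw [rrSum_rec hq m, rrTheta_rec hq m]
    ring
  · simpa using ((tendsto_rrSum hq).const_mul (qPochInf q q)).sub (tendsto_rrTheta hq)

/-! ### Euler's expansion -/

theorem choose_two_succ (n : ℕ) : (n + 1).choose 2 = n.choose 2 + n := by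
  rw [Nat.choose_succ_succ' n 1, Nat.choose_one_right, add_comm]

theorem summable_norm_pow_choose_two {q : ℂ} (hq : ‖q‖ < 1) (z : ℂ) :
    Summable fun r : ℕ => ‖q ^ r.choose 2 * z ^ r‖ := by
  have hlim : Tendsto (fun n : ℕ => ‖q ^ n * z‖) atTop (𝓝 0) := by
    have := ((tendsto_pow_atTop_nhds_zero_of_norm_lt_one hq).mul_const z).norm
    simpa using this
  refine summable_of_ratio_norm_eventually_le (r := 1 / 2) (by norm_num) ?_
  filter_upwards [hlim.eventually_le_const (by norm_num : (0 : ℝ) < 1 / 2)] with n hn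
  rw [norm_norm, norm_norm, choose_two_succ,
    show q ^ (n.choose 2 + n) * z ^ (n + 1) = (q ^ n * z) * (q ^ n.choose 2 * z ^ n) by ring,
    norm_mul]
  gcongr

theorem summable_norm_pow_choose_two_mul {q : ℂ} (hq : ‖q‖ < 1) (z : ℂ) :
    Summable fun r : ℕ => ‖q ^ r.choose 2 * z ^ r * (qPoch q q r)⁻¹‖ := by
  obtain ⟨C, hC⟩ := exists_norm_inv_qPoch_le hq hq
  refine .of_nonneg_of_le (fun _ => norm_nonneg _) (fun r => ?_)
    ((summable_norm_pow_choose_two hq z).mul_right C)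
  rw [norm_mul]
  exact mul_le_mul_of_nonneg_left (hC r) (norm_nonneg _)

/-- Euler's expansion of `(-z; q)_∞`. -/
theorem tsum_euler {q : ℂ} (hq : ‖q‖ < 1) (z : ℂ) :
    ∑' r : ℕ, q ^ r.choose 2 * z ^ r * (qPoch q q r)⁻¹ = qPochInf (-z) q := by
  set f : ℂ → ℂ := fun z => ∑' r : ℕ, q ^ r.choose 2 * z ^ r * (qPoch q q r)⁻¹ with hf
  have hs : ∀ z : ℂ, Summable fun r : ℕ => q ^ r.choose 2 * z ^ r * (qPoch q q r)⁻¹ :=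
    fun z => (summable_norm_pow_choose_two_mul hq z).of_norm
  -- The functional equation of (-z;q)_∞; iterating it moves the argument to z q^n → 0, where the
  -- series tends to 1.
  have hstep : ∀ z, f z = (1 - (-z)) * f (z * q) := by
    intro z
    have key := tsum_add_eq_tsum_of_shift ((hs z).sub (hs (z * q))) (hs (z * q)) (by simp)
      (c := fun r => (1 + z) * (q ^ r.choose 2 * (z * q) ^ r * (qPoch q q r)⁻¹)) (fun n => ?_)
    · simp only [sub_add_cancel] at key
      rw [hf, sub_neg_eq_add]
      simp only
      rw [key, tsum_mul_left]
    · have h1 := qPoch_ne_zero hq hq n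
      have h2 : 1 - q * q ^ n ≠ 0 := one_sub_ne_zero_of_norm (norm_mul_pow_lt_one hq hq n)
      rw [qPoch_succ, choose_two_succ]
      field_simp
      ring
  have hiter : ∀ n, f z = qPoch (-z) q n * f (z * q ^ n) := by
    intro n
    induction n with
    | zero => simp [qPoch_zero]
    | succ n ih => rw [ih, hstep (z * q ^ n), qPoch_succ]; ring_nf
  have hlim : Tendsto (fun n : ℕ => f (z * q ^ n)) atTop (𝓝 1) := by
    have key := tendsto_tsum_of_dominated_convergence (𝓕 := atTop)
      (f := fun (n : ℕ) (r : ℕ) => q ^ r.choose 2 * (z * q ^ n) ^ r * (qPoch q q r)⁻¹)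
      (g := fun r => if r = 0 then 1 else 0) (summable_norm_pow_choose_two_mul hq z)
      (fun r => ?_) (Eventually.of_forall fun n r => ?_)
    · simpa using key
    · by_cases hr : r = 0
      · simp [hr, qPoch_zero]
      · simp only [hr, if_false]
        have h := ((((tendsto_pow_atTop_nhds_zero_of_norm_lt_one hq).const_mul z).pow r).const_mul
          (q ^ r.choose 2)).mul_const (qPoch q q r)⁻¹
        simpa [hr] using h
    · simp only [norm_mul, norm_pow]
      gcongr
      exact mul_le_of_le_one_right (norm_nonneg z) (pow_le_one₀ (norm_nonneg q) hq.le)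
  have h := (tendsto_qPoch (-z) hq).mul hlim
  rw [mul_one] at h
  exact tendsto_nhds_unique (tendsto_const_nhds.congr hiter) h

/-! ### Cauchy's identity and the Jacobi triple product -/

/-- The reciprocal `1 / (q; q)_n` for an integer `n`, which vanishes for negative `n`. -/
noncomputable def qFactInv (q : ℂ) (n : ℤ) : ℂ := if 0 ≤ n then (qPoch q q n.toNat)⁻¹ else 0

theorem qFactInv_natCast (q : ℂ) (n : ℕ) : qFactInv q n = (qPoch q q n)⁻¹ := by
  simp [qFactInv]

theorem qFactInv_of_neg (q : ℂ) {n : ℤ} (hn : n < 0) : qFactInv q n = 0 := by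
  simp [qFactInv, hn]

/-- The value 0 at negative integers is consistent with the recurrence because 1 - q^(n+1) vanishes
at n = -1. -/
theorem qFactInv_eq {q : ℂ} (hq : ‖q‖ < 1) (n : ℤ) :
    qFactInv q n = (1 - q ^ (n + 1)) * qFactInv q (n + 1) := by
  rcases lt_trichotomy n (-1) with h | rfl | h
  · rw [qFactInv_of_neg q (by omega), qFactInv_of_neg q (by omega), mul_zero]
  · simp [qFactInv]
  · lift n to ℕ using by omega
    have h1 := qPoch_ne_zero hq hq n
    have h2 : 1 - q * q ^ n ≠ 0 := one_sub_ne_zero_of_norm (norm_mul_pow_lt_one hq hq n)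
    rw [qFactInv_natCast, ← Nat.cast_succ, qFactInv_natCast, qPoch_succ, zpow_natCast, pow_succ']
    field_simp

theorem exists_norm_qFactInv_le {q : ℂ} (hq : ‖q‖ < 1) : ∃ C, ∀ n, ‖qFactInv q n‖ ≤ C := by
  obtain ⟨C, hC⟩ := exists_norm_inv_qPoch_le hq hq
  refine ⟨C, fun n => ?_⟩
  rw [qFactInv]
  split_ifs
  · exact hC _
  · simpa using (norm_nonneg _).trans (hC 0)

/-- The parameters l and l' are kept apart because the step from l to l + 1 in `tsum_cauchy` needs
the mixed series. -/
theorem summable_cauchy {q : ℂ} (hq : ‖q‖ < 1) (hq0 : q ≠ 0) (l l' : ℤ) :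
    Summable fun j : ℕ => q ^ ((j : ℤ) ^ 2 + l * j) * (qFactInv q (l' + j) * (qPoch q q j)⁻¹) := by
  obtain ⟨C₁, h₁⟩ := exists_norm_qFactInv_le hq
  obtain ⟨C₂, h₂⟩ := exists_norm_inv_qPoch_le hq hq
  have h0 : 0 ≤ C₁ := (norm_nonneg _).trans (h₁ 0)
  have hpos : 0 < ‖q‖ := norm_pos_iff.mpr hq0
  -- The bound comes from j² + lj ≥ j - (l - 1)².
  refine .of_norm_bounded (g := fun j => (‖q‖ ^ (-(l - 1) ^ 2) * ‖q‖ ^ j) * (C₁ * C₂))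
    (((summable_geometric_of_lt_one (norm_nonneg q) hq).mul_left _).mul_right _) fun j => ?_
  rw [norm_mul, norm_mul, norm_zpow, ← zpow_natCast, ← zpow_add₀ hpos.ne']
  refine mul_le_mul ?_ (mul_le_mul (h₁ _) (h₂ j) (norm_nonneg _) h0) (by positivity)
    (by positivity)
  exact zpow_le_zpow_right_of_le_one₀ hpos hq.le (by
    nlinarith [sq_nonneg ((j : ℤ) + (l - 1)), sq_nonneg (j : ℤ), sq_nonneg (l - 1)])

/-- The sum does not depend on l, and as l → ∞ only the term j = 0 survives, with limit 1/(q;q)_∞.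
-/
theorem tsum_cauchy {q : ℂ} (hq : ‖q‖ < 1) (hq0 : q ≠ 0) (l : ℤ) :
    ∑' j : ℕ, q ^ ((j : ℤ) ^ 2 + l * j) * (qFactInv q (l + j) * (qPoch q q j)⁻¹) =
      (qPochInf q q)⁻¹ := by
  set g : ℤ → ℂ := fun l =>
    ∑' j : ℕ, q ^ ((j : ℤ) ^ 2 + l * j) * (qFactInv q (l + j) * (qPoch q q j)⁻¹) with hg
  have hstep : ∀ l, g l = g (l + 1) := by
    intro l
    have hs₁ := summable_cauchy hq hq0 l l
    have hs₂ := summable_cauchy hq hq0 (l + 1) l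
    have hs₃ := summable_cauchy hq hq0 (l + 1) (l + 1)
    have key := tsum_add_eq_tsum_of_shift (hs₁.sub hs₂) hs₂ (by simp)
      (c := fun j : ℕ => q ^ ((j : ℤ) ^ 2 + (l + 1) * j) *
        (qFactInv q (l + 1 + j) * (qPoch q q j)⁻¹)) (fun n => ?_)
    · simp only [sub_add_cancel] at key
      exact key
    · have h1 := qPoch_ne_zero hq hq n
      have h2 : 1 - q * q ^ n ≠ 0 := one_sub_ne_zero_of_norm (norm_mul_pow_lt_one hq hq n)
      have e1 : q ^ (((n + 1 : ℕ) : ℤ) ^ 2 + l * (n + 1 : ℕ)) =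
          q ^ ((n : ℤ) ^ 2 + (l + 1) * n) * q ^ (l + n + 1) := by
        rw [← zpow_add₀ hq0]; push_cast; ring_nf
      have e2 : q ^ (((n + 1 : ℕ) : ℤ) ^ 2 + (l + 1) * (n + 1 : ℕ)) =
          q ^ ((n : ℤ) ^ 2 + (l + 1) * n) * q ^ (l + n + 1) * (q * q ^ n) := by
        rw [← zpow_natCast, ← zpow_one_add₀ hq0, ← zpow_add₀ hq0, ← zpow_add₀ hq0]
        push_cast; ring_nf
      rw [e1, e2, qFactInv_eq hq (l + n), qPoch_succ,
        show l + ((n + 1 : ℕ) : ℤ) = l + n + 1 by push_cast; ring,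
        show l + 1 + (n : ℤ) = l + n + 1 by ring]
      generalize q ^ ((n : ℤ) ^ 2 + (l + 1) * n) = A
      generalize q ^ (l + n + 1) = B
      generalize qFactInv q (l + n + 1) = D
      field_simp
      ring
  have hconst : ∀ (l : ℤ) (n : ℕ), g l = g (l + n) := by
    intro l n
    induction n with
    | zero => simp
    | succ n ih => rw [ih, hstep]; push_cast; ring_nf
  have hnat : Tendsto (fun m : ℕ => g m) atTop (𝓝 (qPochInf q q)⁻¹) := by
    obtain ⟨C₁, h₁⟩ := exists_norm_qFactInv_le hq
    obtain ⟨C₂, h₂⟩ := exists_norm_inv_qPoch_le hq hq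
    have h0 : 0 ≤ C₁ := (norm_nonneg _).trans (h₁ 0)
    have := tendsto_tsum_pow_mul hq (L := (qPochInf q q)⁻¹) (e := fun m n => n ^ 2 + m * n)
      (u := fun m n => qFactInv q ((m : ℤ) + n) * (qPoch q q n)⁻¹) (fun m n => by nlinarith)
      (fun m n hn => by nlinarith [Nat.pos_of_ne_zero hn]) (C := C₁ * C₂)
      (fun m n => by
        rw [norm_mul]; exact mul_le_mul (h₁ _) (h₂ n) (norm_nonneg _) h0)
      (by simpa [qPoch_zero, qFactInv_natCast] using
        (tendsto_qPoch q hq).inv₀ (qPochInf_ne_zero hq hq))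
    refine this.congr fun m => tsum_congr fun n => ?_
    rw [← zpow_natCast]
    push_cast
    rfl
  have hzero : ∀ l, g l = g 0 := by
    intro l
    obtain ⟨n, rfl | rfl⟩ := l.eq_nat_or_neg
    · simpa using (hconst 0 n).symm
    · simpa using hconst (-(n : ℤ)) n
  rw [show (∑' j : ℕ, q ^ ((j : ℤ) ^ 2 + l * j) * (qFactInv q (l + j) * (qPoch q q j)⁻¹)) = g l
    from rfl, hzero]
  exact tendsto_nhds_unique (tendsto_const_nhds.congr fun m : ℕ => (hzero m).symm) hnat

/-- The triangular number `l (l - 1) / 2` of an integer. -/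
def tri (l : ℤ) : ℤ := l * (l - 1) / 2

theorem tri_def (l : ℤ) : tri l = l * (l - 1) / 2 := rfl

theorem two_mul_tri (l : ℤ) : 2 * tri l = l * (l - 1) :=
  Int.mul_ediv_cancel' (Int.even_mul_pred_self l).two_dvd

theorem tri_natCast (n : ℕ) : tri n = n.choose 2 := by
  induction n with
  | zero => simp [tri]
  | succ n ih =>
    have h1 := two_mul_tri n
    have h2 := two_mul_tri (n + 1 : ℕ)
    rw [choose_two_succ]
    push_cast at h2 ⊢
    linarith

theorem tri_succ (l : ℤ) : tri (l + 1) = tri l + l := by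
  have h1 := two_mul_tri l
  have h2 := two_mul_tri (l + 1)
  linarith

attribute [irreducible] tri

/-- Collecting a double series along the diagonals `r - j = l`, using Cauchy's identity. -/
theorem hasSum_diagonal {q : ℂ} (hq : ‖q‖ < 1) (hq0 : q ≠ 0) (φ : ℤ → ℂ) {a : ℂ}
    (h : HasSum (fun p : ℕ × ℕ => φ ((p.1 : ℤ) - p.2) * (q ^ tri p.1 * (qPoch q q p.1)⁻¹ *
      (q ^ tri (p.2 + 1) * (qPoch q q p.2)⁻¹))) a) :
    HasSum (fun l : ℤ => φ l * q ^ tri l * (qPochInf q q)⁻¹) a := by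
  let F : ℤ × ℕ → ℂ := fun p => φ p.1 * q ^ tri p.1 *
    (q ^ ((p.2 : ℤ) ^ 2 + p.1 * p.2) * (qFactInv q (p.1 + p.2) * (qPoch q q p.2)⁻¹))
  have hinj : Function.Injective fun p : ℕ × ℕ => (((p.1 : ℤ) - p.2, p.2) : ℤ × ℕ) := by
    rintro ⟨a, b⟩ ⟨c, d⟩ h
    simp only [Prod.mk.injEq] at h
    obtain ⟨h1, rfl⟩ := h
    simpa using h1
  have hHF : HasSum F a := by
    -- The map (r, j) ↦ (r - j, j) misses exactly the pairs with l + j < 0, where `qFactInv`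
    -- vanishes.
    rw [← hinj.hasSum_iff]
    · refine h.congr_fun fun p => ?_
      simp only [F, Function.comp, sub_add_cancel, qFactInv_natCast]
      -- With l = r - j, this is T(l) + j² + lj = T(r) + T(j + 1).
      have : q ^ tri ((p.1 : ℤ) - p.2) * q ^ ((p.2 : ℤ) ^ 2 + ((p.1 : ℤ) - p.2) * p.2) =
          q ^ tri p.1 * q ^ tri (p.2 + 1) := by
        rw [← zpow_add₀ hq0, ← zpow_add₀ hq0]
        congr 1
        have h1 := two_mul_tri ((p.1 : ℤ) - p.2)
        have h2 := two_mul_tri p.1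
        have h3 := two_mul_tri (p.2 + 1)
        linarith
      linear_combination (φ ((p.1 : ℤ) - p.2) * (qPoch q q p.1)⁻¹ * (qPoch q q p.2)⁻¹) * this
    · rintro ⟨l, j⟩ hx
      have : l + j < 0 := by
        by_contra hlt
        refine hx ⟨((l + j).toNat, j), ?_⟩
        simp only [Prod.mk.injEq, and_true]
        omega
      simp [F, qFactInv_of_neg q this]
  have key : ∀ l : ℤ, HasSum (fun j : ℕ => F (l, j)) (φ l * q ^ tri l * (qPochInf q q)⁻¹) := by
    intro l
    have h := (summable_cauchy hq hq0 l l).hasSum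
    rw [tsum_cauchy hq hq0 l] at h
    refine (h.mul_left (φ l * q ^ tri l)).congr_fun fun j => ?_
    simp only [F]
  exact hHF.prod_fiberwise key

/-- The Jacobi triple product identity. -/
theorem hasSum_jacobi {q : ℂ} (hq : ‖q‖ < 1) (hq0 : q ≠ 0) {z : ℂ} (hz : z ≠ 0) :
    HasSum (fun l : ℤ => z ^ l * q ^ tri l)
      (qPochInf (-z) q * qPochInf (-(q / z)) q * qPochInf q q) := by
  have h₁ := summable_norm_pow_choose_two_mul hq z
  have h₂ := summable_norm_pow_choose_two_mul hq (q / z)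
  have h := (summable_mul_of_summable_norm h₁ h₂).hasSum
  rw [← tsum_mul_tsum_of_summable_norm h₁ h₂, tsum_euler hq, tsum_euler hq] at h
  refine ((hasSum_diagonal hq hq0 (fun l => z ^ l) (h.congr_fun fun p => ?_)).mul_right
    (qPochInf q q)).congr_fun fun l => ?_
  · rw [tri_succ, tri_natCast, tri_natCast, zpow_add₀ hq0, zpow_natCast, zpow_natCast, zpow_natCast,
      zpow_sub₀ hz, zpow_natCast, zpow_natCast, div_pow]
    field_simp
  · rw [mul_assoc, inv_mul_cancel₀ (qPochInf_ne_zero hq hq), mul_one]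

/-! ### Convolution identities from generating functions -/

-- The equation B(qz) = (1 - z) B(z) with B(0) = 1 characterises 1/(z;q)_∞, so convolution
-- identities reduce to checking it.
open PowerSeries in
theorem coeff_eq_inv_qPoch {q : ℂ} (hq : ‖q‖ < 1) {B : PowerSeries ℂ} (h0 : coeff 0 B = 1)
    (h : rescale q B = (1 - X) * B) (n : ℕ) : coeff n B = (qPoch q q n)⁻¹ := by
  induction n with
  | zero => simpa [qPoch_zero] using h0
  | succ n ih =>
    have h1 := congrArg (coeff (n + 1)) h
    rw [coeff_rescale, sub_mul, one_mul, map_sub, coeff_succ_X_mul, ih] at h1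
    have h2 : 1 - q * q ^ n ≠ 0 := one_sub_ne_zero_of_norm (norm_mul_pow_lt_one hq hq n)
    rw [qPoch_succ, mul_inv, eq_mul_inv_iff_mul_eq₀ h2]
    linear_combination -h1

open PowerSeries in
theorem rescale_mk_inv_qPoch {q : ℂ} (hq : ‖q‖ < 1) :
    rescale q (mk fun n => (qPoch q q n)⁻¹) = (1 - X) * mk fun n => (qPoch q q n)⁻¹ := by
  ext n
  cases n with
  | zero => simp [coeff_rescale, sub_mul]
  | succ n =>
    have h1 := qPoch_ne_zero hq hq n
    have h2 : 1 - q * q ^ n ≠ 0 := one_sub_ne_zero_of_norm (norm_mul_pow_lt_one hq hq n)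
    rw [coeff_rescale, sub_mul, one_mul, map_sub, coeff_succ_X_mul, coeff_mk, coeff_mk, qPoch_succ]
    field_simp
    ring

/-- Rogers–Szegő evaluation: `∑_{j+k=n} t ^ j / ((t²; t²)_j (t²; t²)_k) = 1 / (t; t)_n`. -/
theorem sum_antidiagonal_pow_div {t : ℂ} (ht : ‖t‖ < 1) (n : ℕ) :
    ∑ p ∈ Finset.HasAntidiagonal.antidiagonal n,
      t ^ p.1 * (qPoch (t ^ 2) (t ^ 2) p.1)⁻¹ * (qPoch (t ^ 2) (t ^ 2) p.2)⁻¹ =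
    (qPoch t t n)⁻¹ := by
  have hA := rescale_mk_inv_qPoch (norm_pow_lt_one ht two_ne_zero)
  set A : PowerSeries ℂ := PowerSeries.mk fun n => (qPoch (t ^ 2) (t ^ 2) n)⁻¹ with hAdef
  -- In generating functions: 1/(z;t)_∞ = 1/(tz;t²)_∞ · 1/(z;t²)_∞.
  rw [← coeff_eq_inv_qPoch ht (B := PowerSeries.rescale t A * A)]
  · simp [PowerSeries.coeff_mul, hAdef, PowerSeries.coeff_rescale]
  · simp [-PowerSeries.coeff_zero_eq_constantCoeff, PowerSeries.coeff_mul, hAdef,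
      PowerSeries.coeff_rescale, qPoch_zero]
  · rw [map_mul, PowerSeries.rescale_rescale, ← pow_two, hA]
    ring

/-- The coefficients of `1 / (z²; q²)_∞` as a power series in `z`. -/
noncomputable def evenCoeff (q : ℂ) (m : ℕ) : ℂ :=
  if Even m then (qPoch (q ^ 2) (q ^ 2) (m / 2))⁻¹ else 0

theorem evenCoeff_two_mul (q : ℂ) (k : ℕ) :
    evenCoeff q (2 * k) = (qPoch (q ^ 2) (q ^ 2) k)⁻¹ := by simp [evenCoeff]

theorem evenCoeff_odd (q : ℂ) (k : ℕ) : evenCoeff q (2 * k + 1) = 0 := by simp [evenCoeff]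

theorem evenCoeff_add_two {q : ℂ} (hq : ‖q‖ < 1) (m : ℕ) :
    evenCoeff q m = (1 - q ^ (m + 2)) * evenCoeff q (m + 2) := by
  obtain ⟨k, rfl | rfl⟩ := m.even_or_odd'
  · have hq2 := norm_pow_lt_one hq two_ne_zero
    have h1 := qPoch_ne_zero hq2 hq2 k
    have h2 := one_sub_ne_zero_of_norm (norm_mul_pow_lt_one hq2 hq2 k)
    rw [show 2 * k + 2 = 2 * (k + 1) by ring, evenCoeff_two_mul, evenCoeff_two_mul, qPoch_succ,
      pow_mul, pow_succ' (q ^ 2)]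
    field_simp
  · rw [show 2 * k + 1 + 2 = 2 * (k + 1) + 1 by ring, evenCoeff_odd, evenCoeff_odd, mul_zero]

/-- Compares coefficients in 1/(z;q)_∞ = (-z;q)_∞ / (z²;q²)_∞, with Euler's series for (-z;q)_∞. -/
theorem sum_antidiagonal_evenCoeff {q : ℂ} (hq : ‖q‖ < 1) (n : ℕ) :
    ∑ p ∈ Finset.HasAntidiagonal.antidiagonal n,
      evenCoeff q p.1 * (q ^ p.2.choose 2 * (qPoch q q p.2)⁻¹) = (qPoch q q n)⁻¹ := by
  set A : PowerSeries ℂ := PowerSeries.mk (evenCoeff q) with hA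
  set E : PowerSeries ℂ := PowerSeries.mk fun r => q ^ r.choose 2 * (qPoch q q r)⁻¹ with hE
  have hE' : E = (1 + PowerSeries.X) * PowerSeries.rescale q E := by
    ext n
    cases n with
    | zero =>
      simp [-PowerSeries.coeff_zero_eq_constantCoeff, hE, add_mul, PowerSeries.coeff_rescale,
        PowerSeries.coeff_zero_X_mul]
    | succ n =>
      have h1 := qPoch_ne_zero hq hq n
      have h2 : 1 - q * q ^ n ≠ 0 := one_sub_ne_zero_of_norm (norm_mul_pow_lt_one hq hq n)
      rw [add_mul, one_mul, map_add, PowerSeries.coeff_succ_X_mul, PowerSeries.coeff_rescale,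
        PowerSeries.coeff_rescale, hE, PowerSeries.coeff_mk, PowerSeries.coeff_mk, qPoch_succ,
        choose_two_succ]
      field_simp
      ring
  have hA' : PowerSeries.rescale q A = (1 - PowerSeries.X ^ 2) * A := by
    ext n
    rw [sub_mul, one_mul, map_sub, PowerSeries.coeff_rescale, hA, PowerSeries.coeff_mk,
      PowerSeries.coeff_X_pow_mul']
    match n with
    | 0 => simp
    | 1 => simp [evenCoeff]
    | n + 2 =>
      simp only [le_add_iff_nonneg_left, zero_le, if_true, PowerSeries.coeff_mk,
        Nat.add_sub_cancel]
      rw [evenCoeff_add_two hq n]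
      ring
  rw [← coeff_eq_inv_qPoch hq (B := A * E)]
  · simp [PowerSeries.coeff_mul, hA, hE]
  · simp [-PowerSeries.coeff_zero_eq_constantCoeff, PowerSeries.coeff_mul, hA, hE, qPoch_zero,
      evenCoeff]
  -- The functional equation gives only (1 + X) times the rescaled E, so the factor 1 + X has to be
  -- cancelled.
  · have hX : (1 + PowerSeries.X : PowerSeries ℂ) ≠ 0 := by
      intro h
      simpa using congrArg (PowerSeries.coeff 0) h
    refine mul_left_cancel₀ hX ?_
    rw [map_mul, hA']
    conv_rhs => rw [hE']
    ring

theorem tsum_eq_tsum_sum_antidiagonal {f : ℕ × ℕ → ℂ} (hf : Summable f) :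
    ∑' p, f p = ∑' n, ∑ p ∈ Finset.HasAntidiagonal.antidiagonal n, f p := by
  have hs := (Finset.HasAntidiagonal.sigmaAntidiagonalEquivProd (A := ℕ)).summable_iff.mpr hf
  rw [← (Finset.HasAntidiagonal.sigmaAntidiagonalEquivProd (A := ℕ)).tsum_eq f]
  refine (hs.tsum_sigma' fun n => (hasSum_fintype _).summable).trans (tsum_congr fun n => ?_)
  rw [tsum_fintype]
  exact Finset.sum_coe_sort (Finset.HasAntidiagonal.antidiagonal n) f

/-! ### Reduction of the Rogers series to Rogers–Ramanujan -/

/-- The Rogers-type series `∑ t ^ (k ^ 2 + 2 s k) / (t⁴; t⁴)_k`. -/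
noncomputable def rogersSum (t : ℂ) (s : ℕ) : ℂ :=
  ∑' k : ℕ, t ^ (k ^ 2 + 2 * s * k) * (qPoch (t ^ 4) (t ^ 4) k)⁻¹

theorem qPoch_mul_neg (a q : ℂ) (n : ℕ) :
    qPoch a q n * qPoch (-a) q n = qPoch (a ^ 2) (q ^ 2) n := by
  rw [qPoch, qPoch, qPoch, ← Finset.prod_mul_distrib]
  refine Finset.prod_congr rfl fun k _ => ?_
  ring

theorem sq_eq_two_mul_choose_add (n : ℕ) : n ^ 2 = 2 * n.choose 2 + n := by
  induction n with
  | zero => simp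
  | succ n ih => rw [choose_two_succ]; nlinarith

/-- The factor (-t²;t²)_k of the infinite product cancels in (t⁴;t⁴)_k = (t²;t²)_k (-t²;t²)_k.
Euler's series for the tail (-t^(2k+2);t²)_∞ then completes the square, with n = k + r. -/
theorem qPochInf_mul_rogersSum_eq {t : ℂ} (ht : ‖t‖ < 1) (s : ℕ) :
    qPochInf (-t ^ 2) (t ^ 2) * rogersSum t s =
      ∑' n : ℕ, ∑ p ∈ Finset.HasAntidiagonal.antidiagonal n, t ^ (n ^ 2 + 2 * s * p.1 + p.2) *
        ((qPoch (t ^ 2) (t ^ 2) p.1)⁻¹ * (qPoch (t ^ 2) (t ^ 2) p.2)⁻¹) := by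
  have hq := norm_pow_lt_one ht two_ne_zero
  obtain ⟨C, hC⟩ := exists_norm_inv_qPoch_le hq hq
  have hC0 : 0 ≤ C := (norm_nonneg _).trans (hC 0)
  have hsum : Summable fun p : ℕ × ℕ => t ^ ((p.1 + p.2) ^ 2 + 2 * s * p.1 + p.2) *
      ((qPoch (t ^ 2) (t ^ 2) p.1)⁻¹ * (qPoch (t ^ 2) (t ^ 2) p.2)⁻¹) := by
    have hg := summable_geometric_of_lt_one (norm_nonneg t) ht
    refine .of_norm_bounded ((hg.mul_of_nonneg hg (fun _ => by positivity)
      (fun _ => by positivity)).mul_left (C * C)) fun p => ?_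
    rw [← pow_add]
    refine norm_pow_mul_le ht ?_ (by nlinarith [Nat.zero_le (2 * s * p.1)])
    rw [norm_mul]
    exact mul_le_mul (hC _) (hC _) (norm_nonneg _) hC0
  have hrhs := tsum_eq_tsum_sum_antidiagonal hsum
  rw [hsum.tsum_prod] at hrhs
  rw [rogersSum, ← tsum_mul_left]
  refine Eq.trans (tsum_congr fun k => ?_) (hrhs.trans ?_)
  · have h1 : qPochInf (-t ^ 2) (t ^ 2) = qPoch (-t ^ 2) (t ^ 2) k *
        qPochInf (-(t ^ 2 * (t ^ 2) ^ k)) (t ^ 2) := by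
      rw [qPochInf_eq_qPoch_mul (-t ^ 2) hq k, neg_mul]
    have h2 := qPoch_mul_neg (t ^ 2) (t ^ 2) k
    rw [← pow_mul] at h2
    have h3 := qPoch_ne_zero hq hq k
    have h4 : qPoch (-t ^ 2) (t ^ 2) k ≠ 0 := qPoch_ne_zero (by rwa [norm_neg]) hq k
    rw [h1, ← tsum_euler hq, ← h2, show qPoch (-t ^ 2) (t ^ 2) k *
      (∑' r, (t ^ 2) ^ r.choose 2 * (t ^ 2 * (t ^ 2) ^ k) ^ r * (qPoch (t ^ 2) (t ^ 2) r)⁻¹) *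
      (t ^ (k ^ 2 + 2 * s * k) * (qPoch (t ^ 2) (t ^ 2) k * qPoch (-t ^ 2) (t ^ 2) k)⁻¹) =
      (t ^ (k ^ 2 + 2 * s * k) * (qPoch (t ^ 2) (t ^ 2) k)⁻¹) *
      ∑' r, (t ^ 2) ^ r.choose 2 * (t ^ 2 * (t ^ 2) ^ k) ^ r * (qPoch (t ^ 2) (t ^ 2) r)⁻¹ by
        field_simp, ← tsum_mul_left]
    refine tsum_congr fun r => ?_
    have h5 : t ^ ((k + r) ^ 2 + 2 * s * k + r) =
        t ^ (k ^ 2 + 2 * s * k) * ((t ^ 2) ^ r.choose 2 * (t ^ 2 * (t ^ 2) ^ k) ^ r) := by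
      rw [← pow_succ', ← pow_mul, ← pow_mul, ← pow_mul, ← pow_add, ← pow_add]
      congr 1
      have := sq_eq_two_mul_choose_add r
      zify at this ⊢
      linear_combination this
    rw [h5]
    ring
  · refine tsum_congr fun n => Finset.sum_congr rfl fun p hp => ?_
    rw [Finset.HasAntidiagonal.mem_antidiagonal.mp hp]

theorem qPochInf_mul_rogersSum_zero {t : ℂ} (ht : ‖t‖ < 1) :
    qPochInf (-t ^ 2) (t ^ 2) * rogersSum t 0 = rrSum t 0 := by
  rw [qPochInf_mul_rogersSum_eq ht, rrSum]
  refine tsum_congr fun n => ?_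
  rw [← sum_antidiagonal_pow_div ht, Finset.mul_sum,
    ← Finset.Nat.sum_antidiagonal_swap]
  refine Finset.sum_congr rfl fun p _ => ?_
  simp only [Prod.fst_swap, Prod.snd_swap]
  ring

theorem qPochInf_mul_rogersSum_one {t : ℂ} (ht : ‖t‖ < 1) :
    qPochInf (-t ^ 2) (t ^ 2) * rogersSum t 1 = rrSum t 1 := by
  rw [qPochInf_mul_rogersSum_eq ht, rrSum]
  refine tsum_congr fun n => ?_
  rw [← sum_antidiagonal_pow_div ht, Finset.mul_sum]
  refine Finset.sum_congr rfl fun p hp => ?_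
  rw [← Finset.HasAntidiagonal.mem_antidiagonal.mp hp]
  ring

/-! ### Dissections of infinite products and theta functions -/

theorem qPochInf_pow_split_two {x : ℂ} (hx : ‖x‖ < 1) (i : ℕ) {m : ℕ} (hm : m ≠ 0) :
    qPochInf (x ^ i) (x ^ m) =
      qPochInf (x ^ i) (x ^ (2 * m)) * qPochInf (x ^ (i + m)) (x ^ (2 * m)) := by
  rw [qPochInf_eq_prod (x ^ i) (norm_pow_lt_one hx hm) two_ne_zero]
  simp only [Finset.prod_range_succ, Finset.prod_range_zero, one_mul]
  ring_nf

theorem qPochInf_pow_split_five {x : ℂ} (hx : ‖x‖ < 1) (i : ℕ) {m : ℕ} (hm : m ≠ 0) :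
    qPochInf (x ^ i) (x ^ m) =
      qPochInf (x ^ i) (x ^ (5 * m)) * qPochInf (x ^ (i + m)) (x ^ (5 * m)) *
      qPochInf (x ^ (i + 2 * m)) (x ^ (5 * m)) * qPochInf (x ^ (i + 3 * m)) (x ^ (5 * m)) *
      qPochInf (x ^ (i + 4 * m)) (x ^ (5 * m)) := by
  rw [qPochInf_eq_prod (x ^ i) (norm_pow_lt_one hx hm) (by norm_num : (5 : ℕ) ≠ 0)]
  simp only [Finset.prod_range_succ, Finset.prod_range_zero, one_mul]
  ring_nf

theorem qPochInf_pow_mul_neg {x : ℂ} (hx : ‖x‖ < 1) (i : ℕ) {m : ℕ} (hm : m ≠ 0) :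
    qPochInf (x ^ i) (x ^ m) * qPochInf (-x ^ i) (x ^ m) =
      qPochInf (x ^ (2 * i)) (x ^ (2 * m)) := by
  rw [qPochInf_mul_neg _ (norm_pow_lt_one hx hm)]
  ring_nf

theorem qPochInf_neg_base {a y : ℂ} (hy : ‖y‖ < 1) :
    qPochInf a (-y) = qPochInf a (y ^ 2) * qPochInf (-(a * y)) (y ^ 2) := by
  rw [qPochInf_eq_prod a (by rwa [norm_neg] : ‖-y‖ < 1) two_ne_zero]
  simp only [Finset.prod_range_succ, Finset.prod_range_zero, one_mul]
  ring_nf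

theorem qPochInf_pow_ne_zero {x : ℂ} (hx : ‖x‖ < 1) {i m : ℕ} (hi : i ≠ 0) (hm : m ≠ 0) :
    qPochInf (x ^ i) (x ^ m) ≠ 0 :=
  qPochInf_ne_zero (norm_pow_lt_one hx hi) (norm_pow_lt_one hx hm)

/-- The product side of the Jacobi triple product. -/
noncomputable def jacobiProd (z q : ℂ) : ℂ :=
  qPochInf (-z) q * qPochInf (-(q / z)) q * qPochInf q q

theorem jacobiProd_pow {x : ℂ} (hx0 : x ≠ 0) (i j : ℕ) :
    jacobiProd (x ^ i) (x ^ (i + j)) =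
      qPochInf (-x ^ i) (x ^ (i + j)) * qPochInf (-x ^ j) (x ^ (i + j)) *
        qPochInf (x ^ (i + j)) (x ^ (i + j)) := by
  rw [jacobiProd, pow_add, mul_div_cancel_left₀ _ (pow_ne_zero i hx0)]

/-- Splitting a theta series into its even and odd terms. -/
theorem jacobiProd_split {q : ℂ} (hq : ‖q‖ < 1) (hq0 : q ≠ 0) {z : ℂ} (hz : z ≠ 0) :
    jacobiProd z q =
      jacobiProd (z ^ 2 * q) (q ^ 4) + q / z * jacobiProd (z ^ 2 / q) (q ^ 4) := by
  have hq4 := norm_pow_lt_one hq four_ne_zero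
  have h := hasSum_jacobi hq hq0 hz
  have h₁ := hasSum_jacobi hq4 (pow_ne_zero 4 hq0) (mul_ne_zero (pow_ne_zero 2 hz) hq0)
  have h₂ := (hasSum_jacobi hq4 (pow_ne_zero 4 hq0)
    (div_ne_zero (pow_ne_zero 2 hz) hq0)).mul_left (q / z)
  have hinj₁ : Function.Injective fun m : ℤ => 2 * m := fun a b h => by simpa using h
  have hinj₂ : Function.Injective fun m : ℤ => 2 * m - 1 := fun a b h => by simpa using h
  have hcompl : IsCompl (Set.range fun m : ℤ => 2 * m) (Set.range fun m : ℤ => 2 * m - 1) := by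
    rw [isCompl_iff, Set.disjoint_iff, codisjoint_iff_le_sup]
    refine ⟨?_, ?_⟩
    · rintro _ ⟨⟨a, rfl⟩, ⟨b, hb⟩⟩
      simp only at hb
      omega
    · intro n _
      rcases Int.even_or_odd' n with ⟨k, rfl | rfl⟩
      · exact Or.inl ⟨k, rfl⟩
      · exact Or.inr ⟨k + 1, by simp only; ring⟩
  have k₁ : HasSum ((fun l : ℤ => z ^ l * q ^ tri l) ∘ fun m : ℤ => 2 * m)
      (jacobiProd (z ^ 2 * q) (q ^ 4)) := by
    refine h₁.congr_fun fun m => ?_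
    have e : tri (2 * m) = m + 4 * tri m := by
      have := two_mul_tri m
      have := two_mul_tri (2 * m)
      linarith
    simp only [Function.comp]
    rw [e, zpow_add₀ hq0, mul_zpow, zpow_mul, zpow_mul q, mul_assoc]
    norm_cast
  have k₂ : HasSum ((fun l : ℤ => z ^ l * q ^ tri l) ∘ fun m : ℤ => 2 * m - 1)
      (q / z * jacobiProd (z ^ 2 / q) (q ^ 4)) := by
    refine h₂.congr_fun fun m => ?_
    have e : tri (2 * m - 1) = 1 + (-m + 4 * tri m) := by
      have := two_mul_tri m
      have := two_mul_tri (2 * m - 1)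
      linarith
    have := zpow_ne_zero m hq0
    simp only [Function.comp]
    rw [e, zpow_add₀ hq0, zpow_add₀ hq0, div_zpow, zpow_sub₀ hz, zpow_mul, zpow_mul q, zpow_neg,
      zpow_one, zpow_one]
    norm_cast
    field_simp
  exact h.unique (HasSum.add_isCompl hcompl (hinj₁.hasSum_range_iff.mpr k₁)
    (hinj₂.hasSum_range_iff.mpr k₂))

/-! ### Product side of the Rogers–Ramanujan identities -/

theorem neg_pow_zpow_mul {q : ℂ} (hq0 : q ≠ 0) (k m : ℕ) (l : ℤ) :
    (-q ^ k) ^ l * (q ^ m) ^ tri l = (-1) ^ l * q ^ (k * l + m * tri l) := by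
  rw [neg_eq_neg_one_mul, mul_zpow, mul_assoc, ← zpow_natCast q k, ← zpow_natCast q m,
    ← zpow_mul, ← zpow_mul, ← zpow_add₀ hq0]

theorem cast_five_mul_half (n : ℕ) : ((n * (5 * n + 1) / 2 : ℕ) : ℤ) = 3 * n + 5 * tri n := by
  induction n with
  | zero => simp [show tri 0 = 0 from tri_natCast 0]
  | succ n ih =>
    rw [five_mul_half_succ, Nat.cast_add, ih]
    push_cast
    rw [tri_succ]
    ring

theorem rrTheta_zero {q : ℂ} (hq : ‖q‖ < 1) (hq0 : q ≠ 0) :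
    rrTheta q 0 = qPochInf (q ^ 2) (q ^ 5) * qPochInf (q ^ 3) (q ^ 5) * qPochInf (q ^ 5) (q ^ 5) := by
  have h := hasSum_jacobi (norm_pow_lt_one hq (by norm_num : (5 : ℕ) ≠ 0)) (pow_ne_zero 5 hq0)
    (neg_ne_zero.mpr (pow_ne_zero 3 hq0))
  have h' := h.nat_add_neg_add_one.tsum_eq
  rw [neg_neg, div_neg, neg_neg, show q ^ 5 / q ^ 3 = q ^ 2 by field_simp] at h'
  rw [mul_comm (qPochInf (q ^ 2) _), ← h', rrTheta]
  refine tsum_congr fun n => ?_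
  -- The index -(n + 1) is paired with n: its sign is opposite and its exponent larger by 4n + 2,
  -- which yields 1 - q^(4n+2).
  have e' : 3 * (-((n : ℤ) + 1)) + 5 * tri (-(n + 1)) =
      3 * n + 5 * tri n + (4 * n + 2 : ℕ) := by
    have h1 := two_mul_tri n
    have h2 := two_mul_tri (-((n : ℤ) + 1))
    push_cast
    linarith
  rw [neg_pow_zpow_mul hq0, neg_pow_zpow_mul hq0, Nat.cast_ofNat, Nat.cast_ofNat, e',
    ← cast_five_mul_half, ← Nat.cast_add, zpow_neg, ← inv_zpow, inv_neg, inv_one, zpow_add_one₀ (by norm_num)]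
  simp only [zpow_natCast, add_zero, mul_inv_cancel₀ (qPoch_ne_zero hq hq n)]
  ring

/-- The form of `rrTheta_succ` with m = 0 is used because its Pochhammer quotient is 1, so its terms
pair up into a bilateral theta series. -/
theorem rrTheta_one {q : ℂ} (hq : ‖q‖ < 1) (hq0 : q ≠ 0) :
    rrTheta q 1 = qPochInf q (q ^ 5) * qPochInf (q ^ 4) (q ^ 5) * qPochInf (q ^ 5) (q ^ 5) := by
  have h := hasSum_jacobi (norm_pow_lt_one hq (by norm_num : (5 : ℕ) ≠ 0)) (pow_ne_zero 5 hq0)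
    (neg_ne_zero.mpr (pow_ne_zero 4 hq0))
  have h' := h.nat_add_neg_add_one.tsum_eq
  rw [neg_neg, div_neg, neg_neg, show q ^ 5 / q ^ 4 = q by field_simp] at h'
  rw [mul_comm (qPochInf q _), ← h', rrTheta_succ hq 0]
  refine tsum_congr fun n => ?_
  have e : ((n * (5 * n + 1) / 2 + n : ℕ) : ℤ) = 4 * n + 5 * tri n := by
    rw [Nat.cast_add, cast_five_mul_half]
    ring
  have e' : 4 * (-((n : ℤ) + 1)) + 5 * tri (-(n + 1)) =
      4 * n + 5 * tri n + (2 * n + 1 : ℕ) := by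
    have h1 := two_mul_tri n
    have h2 := two_mul_tri (-((n : ℤ) + 1))
    push_cast
    linarith
  rw [neg_pow_zpow_mul hq0, neg_pow_zpow_mul hq0, Nat.cast_ofNat, Nat.cast_ofNat, e', ← e,
    ← Nat.cast_add, zpow_neg, ← inv_zpow, inv_neg, inv_one, zpow_add_one₀ (by norm_num)]
  simp only [zpow_natCast, add_zero, mul_inv_cancel₀ (qPoch_ne_zero hq hq n)]
  ring

theorem rrSum_zero_mul {q : ℂ} (hq : ‖q‖ < 1) (hq0 : q ≠ 0) :
    rrSum q 0 * (qPochInf (q ^ 1) (q ^ 5) * qPochInf (q ^ 4) (q ^ 5)) = 1 := by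
  have h := qPochInf_mul_rrSum hq 0
  have h5 : qPochInf (q ^ 1) (q ^ 1) = qPochInf (q ^ 1) (q ^ 5) * qPochInf (q ^ 2) (q ^ 5) *
    qPochInf (q ^ 3) (q ^ 5) * qPochInf (q ^ 4) (q ^ 5) * qPochInf (q ^ 5) (q ^ 5) :=
    qPochInf_pow_split_five hq 1 one_ne_zero
  rw [pow_one] at h5
  rw [rrTheta_zero hq hq0, h5] at h
  have h2 := qPochInf_pow_ne_zero hq (i := 2) (m := 5) (by norm_num) (by norm_num)
  have h3 := qPochInf_pow_ne_zero hq (i := 3) (m := 5) (by norm_num) (by norm_num)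
  have h4 := qPochInf_pow_ne_zero hq (i := 5) (m := 5) (by norm_num) (by norm_num)
  rw [pow_one]
  refine mul_left_cancel₀ (mul_ne_zero (mul_ne_zero h2 h3) h4) ?_
  linear_combination h

theorem rrSum_one_mul {q : ℂ} (hq : ‖q‖ < 1) (hq0 : q ≠ 0) :
    rrSum q 1 * (qPochInf (q ^ 2) (q ^ 5) * qPochInf (q ^ 3) (q ^ 5)) = 1 := by
  have h := qPochInf_mul_rrSum hq 1
  have h5 : qPochInf (q ^ 1) (q ^ 1) = qPochInf (q ^ 1) (q ^ 5) * qPochInf (q ^ 2) (q ^ 5) *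
    qPochInf (q ^ 3) (q ^ 5) * qPochInf (q ^ 4) (q ^ 5) * qPochInf (q ^ 5) (q ^ 5) :=
    qPochInf_pow_split_five hq 1 one_ne_zero
  rw [pow_one] at h5
  rw [rrTheta_one hq hq0, h5] at h
  have h2 : qPochInf q (q ^ 5) ≠ 0 := qPochInf_ne_zero hq (norm_pow_lt_one hq (by norm_num : (5 : ℕ) ≠ 0))
  have h3 := qPochInf_pow_ne_zero hq (i := 4) (m := 5) (by norm_num) (by norm_num)
  have h4 := qPochInf_pow_ne_zero hq (i := 5) (m := 5) (by norm_num) (by norm_num)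
  refine mul_left_cancel₀ (mul_ne_zero (mul_ne_zero h2 h3) h4) ?_
  linear_combination h

/-! ### Evaluation of the two halves of the Rogers series -/

/-- The terms of even index in `rogersSum t s`, as a series in `x = t ^ 4`. -/
noncomputable def rogersEven (x : ℂ) (s : ℕ) : ℂ :=
  ∑' j : ℕ, x ^ (j ^ 2 + s * j) * (qPoch x x (2 * j))⁻¹

/-- The terms of odd index in `rogersSum t s`, up to the factor `t ^ (2 s + 1)`, as a series in
`x = t ^ 4`. -/
noncomputable def rogersOdd (x : ℂ) (s : ℕ) : ℂ :=
  ∑' j : ℕ, x ^ (j ^ 2 + (s + 1) * j) * (qPoch x x (2 * j + 1))⁻¹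

theorem rogersSum_eq {t : ℂ} (ht : ‖t‖ < 1) (s : ℕ) :
    rogersSum t s = rogersEven (t ^ 4) s + t ^ (2 * s + 1) * rogersOdd (t ^ 4) s := by
  have hx := norm_pow_lt_one ht four_ne_zero
  obtain ⟨C, hC⟩ := exists_norm_inv_qPoch_le hx hx
  let f : ℕ → ℂ := fun k => t ^ (k ^ 2 + 2 * s * k) * (qPoch (t ^ 4) (t ^ 4) k)⁻¹
  have hs : Summable f :=
    summable_pow_mul ht (fun k => by nlinarith [Nat.zero_le (2 * s * k)]) hC
  have he : Summable fun j => f (2 * j) :=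
    hs.comp_injective (i := fun j => 2 * j) fun a b h => by simpa using h
  have ho : Summable fun j => f (2 * j + 1) :=
    hs.comp_injective (i := fun j => 2 * j + 1) fun a b h => by simpa using h
  have key : rogersSum t s = _ := (tsum_even_add_odd he ho).symm
  rw [key]
  rw [rogersEven, rogersOdd, ← tsum_mul_left]
  congr 1
  · refine tsum_congr fun j => ?_
    simp only [f]
    rw [← pow_mul]
    ring_nf
  · refine tsum_congr fun j => ?_
    simp only [f]
    rw [← pow_mul, ← mul_assoc, ← pow_add]
    ring_nf

/-- If `E * rogersSum` is a theta product for both `t` and `-t`, its halves are found by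
comparing even and odd parts. -/
theorem rogers_parts {t E a b : ℂ} (ht : ‖t‖ < 1) (ht0 : t ≠ 0) (s : ℕ)
    (h : rogersSum t s * E = a + t ^ (2 * s + 1) * b)
    (h' : rogersSum (-t) s * E = a - t ^ (2 * s + 1) * b) :
    rogersEven (t ^ 4) s * E = a ∧ rogersOdd (t ^ 4) s * E = b := by
  rw [rogersSum_eq ht] at h
  rw [rogersSum_eq (by rwa [norm_neg]), Even.neg_pow (by decide), Odd.neg_pow ⟨s, rfl⟩] at h'
  refine ⟨by linear_combination (h + h') / 2, ?_⟩
  have := pow_ne_zero (2 * s + 1) ht0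
  refine mul_left_cancel₀ this ?_
  linear_combination (h - h') / 2

theorem rogersSum_zero_mul {t : ℂ} (ht : ‖t‖ < 1) (ht0 : t ≠ 0) :
    rogersSum t 0 * (qPochInf (t ^ 4) (t ^ 20) * qPochInf (t ^ 16) (t ^ 20) *
      qPochInf (t ^ 20) (t ^ 20)) = jacobiProd (t ^ 9) (t ^ 10) := by
  have hR := qPochInf_mul_rogersSum_zero ht
  have hG := rrSum_zero_mul ht ht0
  rw [qPochInf_pow_split_two ht 1 (m := 5) (by norm_num),
    qPochInf_pow_split_two ht 4 (m := 5) (by norm_num)] at hG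
  have e2 := qPochInf_pow_mul_neg ht 2 two_ne_zero
  rw [qPochInf_pow_split_five ht 2 two_ne_zero,
    qPochInf_pow_split_five ht (2 * 2) (m := 2 * 2) (by norm_num)] at e2
  have e3 := qPochInf_pow_split_two ht 2 (m := 10) (by norm_num)
  have e4 := qPochInf_pow_split_two ht 8 (m := 10) (by norm_num)
  have e5 := qPochInf_pow_mul_neg ht 1 (m := 10) (by norm_num)
  have e6 := qPochInf_pow_mul_neg ht 9 (m := 10) (by norm_num)
  have n1 := qPochInf_pow_ne_zero ht (i := 1) (m := 10) (by norm_num) (by norm_num)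
  have n2 := qPochInf_pow_ne_zero ht (i := 9) (m := 10) (by norm_num) (by norm_num)
  have n3 := qPochInf_pow_ne_zero ht (i := 8) (m := 20) (by norm_num) (by norm_num)
  have n4 := qPochInf_pow_ne_zero ht (i := 12) (m := 20) (by norm_num) (by norm_num)
  rw [jacobiProd_pow ht0 9 1]
  rw [← hR] at hG
  norm_num only [] at hG e2 e3 e4 e5 e6 ⊢
  generalize rogersSum t 0 = F at *
  refine mul_left_cancel₀ (mul_ne_zero (mul_ne_zero n1 n2) (mul_ne_zero n3 n4)) ?_
  -- Each summand applies one dissection inside a monomial of infinite products; the chain carries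
  -- one side to the other.
  linear_combination -(F * qPochInf (t ^ 1) (t ^ 10) * qPochInf (t ^ 9) (t ^ 10)) * e2 +
    (qPochInf (t ^ 2) (t ^ 10) * qPochInf (t ^ 8) (t ^ 10) * qPochInf (t ^ 10) (t ^ 10)) * hG +
    (qPochInf (t ^ 8) (t ^ 10) * qPochInf (t ^ 10) (t ^ 10)) * e3 +
    (qPochInf (t ^ 2) (t ^ 20) * qPochInf (t ^ 12) (t ^ 20) * qPochInf (t ^ 10) (t ^ 10)) * e4 -
    (qPochInf (t ^ 12) (t ^ 20) * qPochInf (t ^ 8) (t ^ 20) * qPochInf (t ^ 18) (t ^ 20) *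
      qPochInf (t ^ 10) (t ^ 10)) * e5 -
    (qPochInf (t ^ 1) (t ^ 10) * qPochInf (-t ^ 1) (t ^ 10) * qPochInf (t ^ 12) (t ^ 20) *
      qPochInf (t ^ 8) (t ^ 20) * qPochInf (t ^ 10) (t ^ 10)) * e6

theorem rogersSum_one_mul {t : ℂ} (ht : ‖t‖ < 1) (ht0 : t ≠ 0) :
    rogersSum t 1 * (qPochInf (t ^ 8) (t ^ 20) * qPochInf (t ^ 12) (t ^ 20) *
      qPochInf (t ^ 20) (t ^ 20)) = jacobiProd (t ^ 7) (t ^ 10) := by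
  have hR := qPochInf_mul_rogersSum_one ht
  have hG := rrSum_one_mul ht ht0
  rw [qPochInf_pow_split_two ht 2 (m := 5) (by norm_num),
    qPochInf_pow_split_two ht 3 (m := 5) (by norm_num)] at hG
  have e2 := qPochInf_pow_mul_neg ht 2 two_ne_zero
  rw [qPochInf_pow_split_five ht 2 two_ne_zero,
    qPochInf_pow_split_five ht (2 * 2) (m := 2 * 2) (by norm_num)] at e2
  have e3 := qPochInf_pow_split_two ht 4 (m := 10) (by norm_num)
  have e4 := qPochInf_pow_split_two ht 6 (m := 10) (by norm_num)
  have e5 := qPochInf_pow_mul_neg ht 7 (m := 10) (by norm_num)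
  have e6 := qPochInf_pow_mul_neg ht 3 (m := 10) (by norm_num)
  have n1 := qPochInf_pow_ne_zero ht (i := 3) (m := 10) (by norm_num) (by norm_num)
  have n2 := qPochInf_pow_ne_zero ht (i := 7) (m := 10) (by norm_num) (by norm_num)
  have n3 := qPochInf_pow_ne_zero ht (i := 4) (m := 20) (by norm_num) (by norm_num)
  have n4 := qPochInf_pow_ne_zero ht (i := 16) (m := 20) (by norm_num) (by norm_num)
  rw [jacobiProd_pow ht0 7 3]
  rw [← hR] at hG
  norm_num only [] at hG e2 e3 e4 e5 e6 ⊢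
  generalize rogersSum t 1 = F at *
  refine mul_left_cancel₀ (mul_ne_zero (mul_ne_zero n1 n2) (mul_ne_zero n3 n4)) ?_
  linear_combination -(F * qPochInf (t ^ 3) (t ^ 10) * qPochInf (t ^ 7) (t ^ 10)) * e2 +
    (qPochInf (t ^ 4) (t ^ 10) * qPochInf (t ^ 6) (t ^ 10) * qPochInf (t ^ 10) (t ^ 10)) * hG +
    (qPochInf (t ^ 6) (t ^ 10) * qPochInf (t ^ 10) (t ^ 10)) * e3 +
    (qPochInf (t ^ 4) (t ^ 20) * qPochInf (t ^ 14) (t ^ 20) * qPochInf (t ^ 10) (t ^ 10)) * e4 -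
    (qPochInf (t ^ 4) (t ^ 20) * qPochInf (t ^ 6) (t ^ 20) * qPochInf (t ^ 16) (t ^ 20) *
      qPochInf (t ^ 10) (t ^ 10)) * e5 -
    (qPochInf (t ^ 7) (t ^ 10) * qPochInf (-t ^ 7) (t ^ 10) * qPochInf (t ^ 4) (t ^ 20) *
      qPochInf (t ^ 16) (t ^ 20) * qPochInf (t ^ 10) (t ^ 10)) * e6

theorem rogers_zero_parts {x : ℂ} (hx : ‖x‖ < 1) (hx0 : x ≠ 0) :
    let R := qPochInf (x ^ 1) (x ^ 5) * qPochInf (x ^ 4) (x ^ 5) * qPochInf (x ^ 5) (x ^ 5)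
    rogersEven x 0 * R = jacobiProd (x ^ 7) (x ^ 10) ∧
      rogersOdd x 0 * R = jacobiProd (x ^ 2) (x ^ 10) := by
  -- The halves are series in x, but separating them needs the sign change of a fourth root t.
  obtain ⟨t, rfl⟩ := IsAlgClosed.exists_pow_nat_eq x (n := 4) (by norm_num)
  have ht0 : t ≠ 0 := by rintro rfl; simp at hx0
  have ht : ‖t‖ < 1 := by
    rw [norm_pow] at hx
    exact lt_of_pow_lt_pow_left₀ 4 zero_le_one (by simpa using hx)
  have hs : ∀ t : ℂ, ‖t‖ < 1 → t ≠ 0 → rogersSum t 0 * (qPochInf (t ^ 4) (t ^ 20) *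
      qPochInf (t ^ 16) (t ^ 20) * qPochInf (t ^ 20) (t ^ 20)) =
      jacobiProd (t ^ 28) (t ^ 40) + t * jacobiProd (t ^ 8) (t ^ 40) := by
    intro t ht ht0
    -- For z = t⁹ and base t¹⁰ the split has z²·t¹⁰ = t²⁸, t¹⁰/z = t and z²/t¹⁰ = t⁸.
    rw [rogersSum_zero_mul ht ht0, jacobiProd_split (norm_pow_lt_one ht (by norm_num))
      (pow_ne_zero _ ht0) (pow_ne_zero _ ht0)]
    congr 2
    · ring
    · ring
    · field_simp
    · congr 1
      · field_simp
      · ring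
  have hneg := hs (-t) (by rwa [norm_neg]) (neg_ne_zero.mpr ht0)
  simp only [Even.neg_pow (by decide : Even 4), Even.neg_pow (by decide : Even 20),
    Even.neg_pow (by decide : Even 16), Even.neg_pow (by decide : Even 28),
    Even.neg_pow (by decide : Even 40), Even.neg_pow (by decide : Even 8)] at hneg
  have h := rogers_parts ht ht0 0 (by simpa using hs t ht ht0)
    (by simpa [sub_eq_add_neg] using hneg)
  simpa only [← pow_mul, Nat.reduceMul] using h

theorem rogers_one_parts {x : ℂ} (hx : ‖x‖ < 1) (hx0 : x ≠ 0) :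
    let R := qPochInf (x ^ 2) (x ^ 5) * qPochInf (x ^ 3) (x ^ 5) * qPochInf (x ^ 5) (x ^ 5)
    rogersEven x 1 * R = jacobiProd (x ^ 6) (x ^ 10) ∧
      rogersOdd x 1 * R = jacobiProd (x ^ 1) (x ^ 10) := by
  obtain ⟨t, rfl⟩ := IsAlgClosed.exists_pow_nat_eq x (n := 4) (by norm_num)
  have ht0 : t ≠ 0 := by rintro rfl; simp at hx0
  have ht : ‖t‖ < 1 := by
    rw [norm_pow] at hx
    exact lt_of_pow_lt_pow_left₀ 4 zero_le_one (by simpa using hx)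
  have hs : ∀ t : ℂ, ‖t‖ < 1 → t ≠ 0 → rogersSum t 1 * (qPochInf (t ^ 8) (t ^ 20) *
      qPochInf (t ^ 12) (t ^ 20) * qPochInf (t ^ 20) (t ^ 20)) =
      jacobiProd (t ^ 24) (t ^ 40) + t ^ 3 * jacobiProd (t ^ 4) (t ^ 40) := by
    intro t ht ht0
    -- For z = t⁷ and base t¹⁰ the split has z²·t¹⁰ = t²⁴, t¹⁰/z = t³ and z²/t¹⁰ = t⁴.
    rw [rogersSum_one_mul ht ht0, jacobiProd_split (norm_pow_lt_one ht (by norm_num))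
      (pow_ne_zero _ ht0) (pow_ne_zero _ ht0)]
    congr 2
    · ring
    · ring
    · field_simp
    · congr 1
      · field_simp
      · ring
  have hneg := hs (-t) (by rwa [norm_neg]) (neg_ne_zero.mpr ht0)
  simp only [Even.neg_pow (by decide : Even 4), Even.neg_pow (by decide : Even 20),
    Even.neg_pow (by decide : Even 12), Even.neg_pow (by decide : Even 24),
    Even.neg_pow (by decide : Even 40), Even.neg_pow (by decide : Even 8),
    Odd.neg_pow (by decide : Odd 3)] at hneg
  have h := rogers_parts ht ht0 1 (by simpa using hs t ht ht0)
    (by simpa [sub_eq_add_neg] using hneg)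
  simpa only [← pow_mul, Nat.reduceMul] using h

theorem qPochInf_pow_ten_factors {x : ℂ} (hx : ‖x‖ < 1) :
    qPochInf (x ^ 1) (x ^ 2) = qPochInf (x ^ 1) (x ^ 10) * qPochInf (x ^ 3) (x ^ 10) *
      qPochInf (x ^ 5) (x ^ 10) * qPochInf (x ^ 7) (x ^ 10) * qPochInf (x ^ 9) (x ^ 10) :=
  qPochInf_pow_split_five hx 1 two_ne_zero

theorem five_ne_zero_nat : (5 : ℕ) ≠ 0 := by norm_num

/-- The theta quotient from `rogers_zero_parts` is simplified by dissecting all products to moduli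
10 and 20; the three companions below work alike. -/
theorem rogersEven_zero {x : ℂ} (hx : ‖x‖ < 1) (hx0 : x ≠ 0) :
    rogersEven x 0 * (qPochInf x (x ^ 2) * qPochInf₂ (x ^ 4) (x ^ 16) (x ^ 20)) = 1 := by
  have h := (rogers_zero_parts hx hx0).1
  have r1 := qPochInf_pow_ne_zero hx (i := 1) (m := 5) (by norm_num) (by norm_num)
  have r2 := qPochInf_pow_ne_zero hx (i := 4) (m := 5) (by norm_num) (by norm_num)
  have r3 := qPochInf_pow_ne_zero hx (i := 5) (m := 5) (by norm_num) (by norm_num)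
  have s1 := qPochInf_pow_split_two hx 1 (m := 5) (by norm_num)
  have s2 := qPochInf_pow_split_two hx 4 (m := 5) (by norm_num)
  have s3 := qPochInf_pow_split_two hx 5 (m := 5) (by norm_num)
  have u4 := qPochInf_pow_split_two hx 4 (m := 10) (by norm_num)
  have u6 := qPochInf_pow_split_two hx 6 (m := 10) (by norm_num)
  have v7 := qPochInf_pow_mul_neg hx 7 (m := 10) (by norm_num)
  have v3 := qPochInf_pow_mul_neg hx 3 (m := 10) (by norm_num)
  have hten := qPochInf_pow_ten_factors hx
  rw [jacobiProd_pow hx0 7 3] at h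
  norm_num only [] at h s1 s2 s3 u4 u6 v7 v3
  refine mul_left_cancel₀ (mul_ne_zero (mul_ne_zero r1 r2) r3) ?_
  rw [s1, s2, s3] at h ⊢
  rw [show qPochInf x (x ^ 2) = qPochInf (x ^ 1) (x ^ 2) by rw [pow_one], hten, qPochInf₂]
  generalize qPochInf (x ^ 1) (x ^ 10) = c1 at *
  generalize qPochInf (x ^ 3) (x ^ 10) = c3 at *
  generalize qPochInf (x ^ 4) (x ^ 10) = c4 at *
  generalize qPochInf (x ^ 5) (x ^ 10) = c5 at *
  generalize qPochInf (x ^ 6) (x ^ 10) = c6 at *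
  generalize qPochInf (x ^ 7) (x ^ 10) = c7 at *
  generalize qPochInf (x ^ 9) (x ^ 10) = c9 at *
  generalize qPochInf (x ^ 10) (x ^ 10) = c10 at *
  generalize qPochInf (-x ^ 3) (x ^ 10) = n3 at *
  generalize qPochInf (-x ^ 7) (x ^ 10) = n7 at *
  generalize qPochInf (x ^ 4) (x ^ 20) = d4 at *
  generalize qPochInf (x ^ 6) (x ^ 20) = d6 at *
  generalize qPochInf (x ^ 14) (x ^ 20) = d14 at *
  generalize qPochInf (x ^ 16) (x ^ 20) = d16 at *
  linear_combination (c1 * c3 * c5 * c7 * c9 * d4 * d16) * h +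
    (n3 * c10 * c1 * c3 * c5 * c9 * d4 * d16) * v7 +
    (c10 * c1 * c5 * c9 * d4 * d16 * d14) * v3 -
    (c1 * c6 * c9 * c5 * c10) * u4 -
    (c1 * c9 * c5 * c10 * d4 * d14) * u6

theorem rogersOdd_zero {x : ℂ} (hx : ‖x‖ < 1) (hx0 : x ≠ 0) :
    rogersOdd x 0 * (qPochInf x (x ^ 2) * qPochInf₂ (x ^ 2) (-x ^ 3) (-x ^ 5)) = 1 := by
  have h := (rogers_zero_parts hx hx0).2
  have r1 := qPochInf_pow_ne_zero hx (i := 1) (m := 5) (by norm_num) (by norm_num)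
  have r2 := qPochInf_pow_ne_zero hx (i := 4) (m := 5) (by norm_num) (by norm_num)
  have r3 := qPochInf_pow_ne_zero hx (i := 5) (m := 5) (by norm_num) (by norm_num)
  have s1 := qPochInf_pow_split_two hx 1 (m := 5) (by norm_num)
  have s2 := qPochInf_pow_split_two hx 4 (m := 5) (by norm_num)
  have s3 := qPochInf_pow_split_two hx 5 (m := 5) (by norm_num)
  have u4 := qPochInf_pow_split_two hx 4 (m := 10) (by norm_num)
  have u6 := qPochInf_pow_split_two hx 6 (m := 10) (by norm_num)
  have v7 := qPochInf_pow_mul_neg hx 7 (m := 10) (by norm_num)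
  have v3 := qPochInf_pow_mul_neg hx 3 (m := 10) (by norm_num)
  have v2 := qPochInf_pow_mul_neg hx 2 (m := 10) (by norm_num)
  have v8 := qPochInf_pow_mul_neg hx 8 (m := 10) (by norm_num)
  have hten := qPochInf_pow_ten_factors hx
  rw [jacobiProd_pow hx0 2 8] at h
  -- Symbols of base -x⁵ are rewritten in base x¹⁰ to join the common dissection.
  have w2 := qPochInf_neg_base (a := x ^ 2) (norm_pow_lt_one hx five_ne_zero_nat)
  have w3 := qPochInf_neg_base (a := -x ^ 3) (norm_pow_lt_one hx five_ne_zero_nat)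
  simp only [neg_mul, neg_neg, ← pow_add, ← pow_mul, Nat.reduceAdd, Nat.reduceMul] at w2 w3
  norm_num only [] at h s1 s2 s3 u4 u6 v7 v3 v2 v8
  refine mul_left_cancel₀ (mul_ne_zero (mul_ne_zero r1 r2) r3) ?_
  rw [s1, s2, s3] at h ⊢
  rw [show qPochInf x (x ^ 2) = qPochInf (x ^ 1) (x ^ 2) by rw [pow_one], hten, qPochInf₂, w2, w3]
  generalize qPochInf (x ^ 1) (x ^ 10) = c1 at *
  generalize qPochInf (x ^ 2) (x ^ 10) = c2 at *
  generalize qPochInf (x ^ 3) (x ^ 10) = c3 at *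
  generalize qPochInf (x ^ 4) (x ^ 10) = c4 at *
  generalize qPochInf (x ^ 5) (x ^ 10) = c5 at *
  generalize qPochInf (x ^ 6) (x ^ 10) = c6 at *
  generalize qPochInf (x ^ 7) (x ^ 10) = c7 at *
  generalize qPochInf (x ^ 8) (x ^ 10) = c8 at *
  generalize qPochInf (x ^ 9) (x ^ 10) = c9 at *
  generalize qPochInf (x ^ 10) (x ^ 10) = c10 at *
  generalize qPochInf (-x ^ 2) (x ^ 10) = n2 at *
  generalize qPochInf (-x ^ 3) (x ^ 10) = n3 at *
  generalize qPochInf (-x ^ 7) (x ^ 10) = n7 at *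
  generalize qPochInf (-x ^ 8) (x ^ 10) = n8 at *
  generalize qPochInf (x ^ 4) (x ^ 20) = d4 at *
  generalize qPochInf (x ^ 6) (x ^ 20) = d6 at *
  generalize qPochInf (x ^ 14) (x ^ 20) = d14 at *
  generalize qPochInf (x ^ 16) (x ^ 20) = d16 at *
  linear_combination (c1 * c3 * c5 * c7 * c9 * c2 * n7 * n3 * c8) * h +
    (n2 * n8 * c10 * c1 * c3 * c5 * c9 * c2 * n3 * c8) * v7 +
    (n2 * n8 * c10 * c1 * c5 * c9 * c2 * c8 * d14) * v3 +
    (n8 * c10 * c1 * c5 * c9 * c8 * d14 * d6) * v2 +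
    (c10 * c1 * c5 * c9 * d14 * d6 * d4) * v8 -
    (c1 * c6 * c9 * c5 * c10) * u4 -
    (c1 * c9 * c5 * c10 * d4 * d14) * u6

theorem rogersEven_one {x : ℂ} (hx : ‖x‖ < 1) (hx0 : x ≠ 0) :
    rogersEven x 1 * (qPochInf x (x ^ 2) * qPochInf₂ (-x ^ 1) (x ^ 4) (-x ^ 5)) = 1 := by
  have h := (rogers_one_parts hx hx0).1
  have r1 := qPochInf_pow_ne_zero hx (i := 2) (m := 5) (by norm_num) (by norm_num)
  have r2 := qPochInf_pow_ne_zero hx (i := 3) (m := 5) (by norm_num) (by norm_num)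
  have r3 := qPochInf_pow_ne_zero hx (i := 5) (m := 5) (by norm_num) (by norm_num)
  have s1 := qPochInf_pow_split_two hx 2 (m := 5) (by norm_num)
  have s2 := qPochInf_pow_split_two hx 3 (m := 5) (by norm_num)
  have s3 := qPochInf_pow_split_two hx 5 (m := 5) (by norm_num)
  have u2 := qPochInf_pow_split_two hx 2 (m := 10) (by norm_num)
  have u8 := qPochInf_pow_split_two hx 8 (m := 10) (by norm_num)
  have v6 := qPochInf_pow_mul_neg hx 6 (m := 10) (by norm_num)
  have v4 := qPochInf_pow_mul_neg hx 4 (m := 10) (by norm_num)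
  have v1 := qPochInf_pow_mul_neg hx 1 (m := 10) (by norm_num)
  have v9 := qPochInf_pow_mul_neg hx 9 (m := 10) (by norm_num)
  have hten := qPochInf_pow_ten_factors hx
  rw [jacobiProd_pow hx0 6 4] at h
  have w1 := qPochInf_neg_base (a := -x ^ 1) (norm_pow_lt_one hx five_ne_zero_nat)
  have w4 := qPochInf_neg_base (a := x ^ 4) (norm_pow_lt_one hx five_ne_zero_nat)
  simp only [neg_mul, neg_neg, ← pow_add, ← pow_mul, Nat.reduceAdd, Nat.reduceMul] at w1 w4
  norm_num only [] at h s1 s2 s3 u2 u8 v6 v4 v1 v9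
  refine mul_left_cancel₀ (mul_ne_zero (mul_ne_zero r1 r2) r3) ?_
  rw [s1, s2, s3] at h ⊢
  rw [show qPochInf x (x ^ 2) = qPochInf (x ^ 1) (x ^ 2) by rw [pow_one], hten, qPochInf₂, w1, w4]
  generalize qPochInf (x ^ 1) (x ^ 10) = c1 at *
  generalize qPochInf (x ^ 2) (x ^ 10) = c2 at *
  generalize qPochInf (x ^ 3) (x ^ 10) = c3 at *
  generalize qPochInf (x ^ 4) (x ^ 10) = c4 at *
  generalize qPochInf (x ^ 5) (x ^ 10) = c5 at *
  generalize qPochInf (x ^ 6) (x ^ 10) = c6 at *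
  generalize qPochInf (x ^ 7) (x ^ 10) = c7 at *
  generalize qPochInf (x ^ 8) (x ^ 10) = c8 at *
  generalize qPochInf (x ^ 9) (x ^ 10) = c9 at *
  generalize qPochInf (x ^ 10) (x ^ 10) = c10 at *
  generalize qPochInf (-x ^ 1) (x ^ 10) = n1 at *
  generalize qPochInf (-x ^ 4) (x ^ 10) = n4 at *
  generalize qPochInf (-x ^ 6) (x ^ 10) = n6 at *
  generalize qPochInf (-x ^ 9) (x ^ 10) = n9 at *
  generalize qPochInf (x ^ 2) (x ^ 20) = d2 at *
  generalize qPochInf (x ^ 8) (x ^ 20) = d8 at *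
  generalize qPochInf (x ^ 12) (x ^ 20) = d12 at *
  generalize qPochInf (x ^ 18) (x ^ 20) = d18 at *
  linear_combination (c1 * c3 * c5 * c7 * c9 * n1 * c6 * c4 * n9) * h +
    (n4 * c10 * c1 * c3 * c5 * c7 * c9 * n1 * c4 * n9) * v6 +
    (c10 * c1 * c3 * c5 * c7 * c9 * n1 * n9 * d12) * v4 +
    (c10 * c3 * c5 * c7 * c9 * n9 * d12 * d8) * v1 +
    (c10 * c3 * c5 * c7 * d12 * d8 * d2) * v9 -
    (c7 * c3 * c8 * c5 * c10) * u2 -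
    (c7 * c3 * c5 * c10 * d2 * d12) * u8

theorem rogersOdd_one {x : ℂ} (hx : ‖x‖ < 1) (hx0 : x ≠ 0) :
    rogersOdd x 1 * (qPochInf x (x ^ 2) * qPochInf₂ (x ^ 8) (x ^ 12) (x ^ 20)) = 1 := by
  have h := (rogers_one_parts hx hx0).2
  have r1 := qPochInf_pow_ne_zero hx (i := 2) (m := 5) (by norm_num) (by norm_num)
  have r2 := qPochInf_pow_ne_zero hx (i := 3) (m := 5) (by norm_num) (by norm_num)
  have r3 := qPochInf_pow_ne_zero hx (i := 5) (m := 5) (by norm_num) (by norm_num)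
  have s1 := qPochInf_pow_split_two hx 2 (m := 5) (by norm_num)
  have s2 := qPochInf_pow_split_two hx 3 (m := 5) (by norm_num)
  have s3 := qPochInf_pow_split_two hx 5 (m := 5) (by norm_num)
  have u2 := qPochInf_pow_split_two hx 2 (m := 10) (by norm_num)
  have u8 := qPochInf_pow_split_two hx 8 (m := 10) (by norm_num)
  have v1 := qPochInf_pow_mul_neg hx 1 (m := 10) (by norm_num)
  have v9 := qPochInf_pow_mul_neg hx 9 (m := 10) (by norm_num)
  have hten := qPochInf_pow_ten_factors hx
  rw [jacobiProd_pow hx0 1 9] at h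
  norm_num only [] at h s1 s2 s3 u2 u8 v1 v9
  refine mul_left_cancel₀ (mul_ne_zero (mul_ne_zero r1 r2) r3) ?_
  rw [s1, s2, s3] at h ⊢
  rw [show qPochInf x (x ^ 2) = qPochInf (x ^ 1) (x ^ 2) by rw [pow_one], hten, qPochInf₂]
  generalize qPochInf (x ^ 1) (x ^ 10) = c1 at *
  generalize qPochInf (x ^ 2) (x ^ 10) = c2 at *
  generalize qPochInf (x ^ 3) (x ^ 10) = c3 at *
  generalize qPochInf (x ^ 5) (x ^ 10) = c5 at *
  generalize qPochInf (x ^ 7) (x ^ 10) = c7 at *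
  generalize qPochInf (x ^ 8) (x ^ 10) = c8 at *
  generalize qPochInf (x ^ 9) (x ^ 10) = c9 at *
  generalize qPochInf (x ^ 10) (x ^ 10) = c10 at *
  generalize qPochInf (-x ^ 1) (x ^ 10) = n1 at *
  generalize qPochInf (-x ^ 9) (x ^ 10) = n9 at *
  generalize qPochInf (x ^ 2) (x ^ 20) = d2 at *
  generalize qPochInf (x ^ 8) (x ^ 20) = d8 at *
  generalize qPochInf (x ^ 12) (x ^ 20) = d12 at *
  generalize qPochInf (x ^ 18) (x ^ 20) = d18 at *
  linear_combination (c1 * c3 * c5 * c7 * c9 * d8 * d12) * h +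
    (n9 * c10 * c3 * c5 * c7 * c9 * d8 * d12) * v1 +
    (c10 * c3 * c5 * c7 * d8 * d12 * d2) * v9 -
    (c7 * c3 * c8 * c5 * c10) * u2 -
    (c7 * c3 * c5 * c10 * d2 * d12) * u8

/-! ### Reduction of the Nahm sums to theta functions and Rogers halves -/

/-- The summand of a Nahm sum in the variables `i - j` and `j`. -/
noncomputable def nahmTerm (q : ℂ) (s : ℤ) (i j : ℕ) : ℂ :=
  q ^ (s * ((i : ℤ) - j) + tri ((i : ℤ) - j)) * ((q ^ 3) ^ tri (j + 1) *
    (qPoch (q ^ 3) (q ^ 3) j)⁻¹) * (qPoch (q ^ 3) (q ^ 3) i)⁻¹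

theorem summable_norm_zpow_tri {q : ℂ} (hq : ‖q‖ < 1) (hq0 : q ≠ 0) (s : ℤ) :
    Summable fun n : ℤ => ‖q ^ (s * n + tri n)‖ := by
  refine ((hasSum_jacobi hq hq0 (zpow_ne_zero s hq0)).summable.congr fun n => ?_).norm
  rw [zpow_add₀ hq0, zpow_mul]

theorem summable_norm_zpow_tri_mul {q : ℂ} (hq : ‖q‖ < 1) :
    Summable fun r : ℕ => ‖q ^ tri r * (qPoch q q r)⁻¹‖ := by
  refine (summable_norm_pow_choose_two_mul hq 1).congr fun r => ?_
  rw [tri_natCast, zpow_natCast, one_pow, mul_one]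

theorem summable_norm_zpow_tri_succ_mul {q : ℂ} (hq : ‖q‖ < 1) :
    Summable fun r : ℕ => ‖q ^ tri (r + 1) * (qPoch q q r)⁻¹‖ := by
  refine (summable_norm_pow_choose_two_mul hq q).congr fun r => ?_
  rw [← Nat.cast_succ, tri_natCast, zpow_natCast, choose_two_succ, pow_add]

/-- In the coordinates (i - j, j) the terms are dominated by a theta series times an Euler series,
since 1/(q³;q³)_i is bounded. -/
theorem summable_nahmTerm {q : ℂ} (hq : ‖q‖ < 1) (hq0 : q ≠ 0) (s : ℤ) :
    Summable fun p : ℕ × ℕ => nahmTerm q s p.1 p.2 := by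
  have hQ := norm_pow_lt_one hq three_ne_zero
  obtain ⟨C, hC⟩ := exists_norm_inv_qPoch_le hQ hQ
  have hg := summable_mul_of_summable_norm (summable_norm_zpow_tri hq hq0 s)
    (summable_norm_zpow_tri_succ_mul hQ)
  have hinj : Function.Injective fun p : ℕ × ℕ => (((p.1 : ℤ) - p.2, p.2) : ℤ × ℕ) := by
    rintro ⟨a, b⟩ ⟨c, d⟩ h
    simp only [Prod.mk.injEq] at h ⊢
    omega
  refine .of_norm_bounded ((hg.comp_injective hinj).norm.mul_right C) fun p => ?_
  rw [nahmTerm, norm_mul]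
  exact mul_le_mul_of_nonneg_left (hC _) (norm_nonneg _)

theorem exists_norm_evenCoeff_le {q : ℂ} (hq : ‖q‖ < 1) : ∃ C, ∀ m, ‖evenCoeff q m‖ ≤ C := by
  have hq2 := norm_pow_lt_one hq two_ne_zero
  obtain ⟨C, hC⟩ := exists_norm_inv_qPoch_le hq2 hq2
  refine ⟨C, fun m => ?_⟩
  rw [evenCoeff]
  split_ifs
  · exact hC _
  · simpa using (norm_nonneg _).trans (hC 0)

/-- The triple series obtained from the Nahm sum by expanding `1 / (q³; q³)_i`. -/
noncomputable def nahmTriple (q : ℂ) (s : ℤ) (p : ℕ × (ℕ × ℕ)) : ℂ :=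
  evenCoeff (q ^ 3) p.1 * (q ^ (s * (p.1 + ((p.2.1 : ℤ) - p.2.2)) +
    tri (p.1 + ((p.2.1 : ℤ) - p.2.2))) *
    ((q ^ 3) ^ tri p.2.1 * (qPoch (q ^ 3) (q ^ 3) p.2.1)⁻¹ *
      ((q ^ 3) ^ tri (p.2.2 + 1) * (qPoch (q ^ 3) (q ^ 3) p.2.2)⁻¹)))

theorem summable_nahmTriple {q : ℂ} (hq : ‖q‖ < 1) (hq0 : q ≠ 0) (s : ℤ) :
    Summable (nahmTriple q s) := by
  have hQ := norm_pow_lt_one hq three_ne_zero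
  obtain ⟨C, hC⟩ := exists_norm_evenCoeff_le hQ
  have hg := summable_mul_of_summable_norm (summable_norm_zpow_tri hq hq0 s)
    ((summable_norm_zpow_tri_mul hQ).mul_norm (summable_norm_zpow_tri_succ_mul hQ))
  have hinj : Function.Injective fun p : ℕ × (ℕ × ℕ) =>
      (((p.1 + ((p.2.1 : ℤ) - p.2.2)), p.2) : ℤ × (ℕ × ℕ)) := by
    rintro ⟨a, b, c⟩ ⟨d, e, f⟩ h
    simp only [Prod.mk.injEq] at h ⊢
    omega
  refine .of_norm_bounded ((hg.comp_injective hinj).norm.mul_left C) fun p => ?_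
  rw [nahmTriple, norm_mul]
  exact mul_le_mul_of_nonneg_right (hC _) (norm_nonneg _)

theorem tsum_nahmTerm_eq_tsum_nahmTriple {q : ℂ} (hq : ‖q‖ < 1) (hq0 : q ≠ 0) (s : ℤ) :
    ∑' p : ℕ × ℕ, nahmTerm q s p.1 p.2 = ∑' p, nahmTriple q s p := by
  have hQ := norm_pow_lt_one hq three_ne_zero
  -- The index j is moved outermost, so that the other two can be collected along m + r = i.
  let e : ℕ × (ℕ × ℕ) ≃ ℕ × (ℕ × ℕ) := (Equiv.prodComm _ _).trans (Equiv.prodAssoc _ _ _)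
  have hT : Summable (nahmTriple q s ∘ e) := e.summable_iff.mpr (summable_nahmTriple hq hq0 s)
  have hN : Summable fun p : ℕ × ℕ => nahmTerm q s p.2 p.1 :=
    (summable_nahmTerm hq hq0 s).prod_symm
  have h₁ : ∑' p : ℕ × ℕ, nahmTerm q s p.1 p.2 = ∑' p : ℕ × ℕ, nahmTerm q s p.2 p.1 :=
    ((Equiv.prodComm ℕ ℕ).tsum_eq fun p : ℕ × ℕ => nahmTerm q s p.1 p.2).symm
  have h₂ : ∑' p, nahmTriple q s p = ∑' p, (nahmTriple q s ∘ e) p := (e.tsum_eq _).symm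
  rw [h₁, h₂, hN.tsum_prod, hT.tsum_prod]
  refine tsum_congr fun j => ?_
  rw [tsum_eq_tsum_sum_antidiagonal (hT.prod_factor j)]
  refine tsum_congr fun i => ?_
  rw [nahmTerm, ← sum_antidiagonal_evenCoeff hQ i, Finset.mul_sum]
  refine Finset.sum_congr rfl fun p hp => ?_
  rw [← Finset.HasAntidiagonal.mem_antidiagonal.mp hp]
  simp only [nahmTriple, Function.comp, e, Equiv.trans_apply, Equiv.prodComm_apply, Prod.swap,
    Equiv.prodAssoc_apply]
  rw [tri_natCast, zpow_natCast, Nat.cast_add, add_sub_assoc]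
  ring

/-- The inner bilateral theta series. -/
noncomputable def nahmTheta (q : ℂ) (s : ℤ) (k : ℕ) : ℂ :=
  ∑' l : ℤ, q ^ (s * ((2 * k : ℕ) + l) + tri ((2 * k : ℕ) + l)) * (q ^ 3) ^ tri l

theorem tsum_nahmTerm {q : ℂ} (hq : ‖q‖ < 1) (hq0 : q ≠ 0) (s : ℤ) :
    ∑' p : ℕ × ℕ, nahmTerm q s p.1 p.2 = (qPochInf (q ^ 3) (q ^ 3))⁻¹ *
      (∑' j : ℕ, nahmTheta q s (2 * j) * (qPoch (q ^ 6) (q ^ 6) (2 * j))⁻¹ +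
        ∑' j : ℕ, nahmTheta q s (2 * j + 1) * (qPoch (q ^ 6) (q ^ 6) (2 * j + 1))⁻¹) := by
  have hQ := norm_pow_lt_one hq three_ne_zero
  have hT := summable_nahmTriple hq hq0 s
  let f : ℕ → ℂ := fun m => ∑' p : ℕ × ℕ, nahmTriple q s (m, p)
  let g : ℕ → ℂ := fun k => nahmTheta q s k * (qPoch (q ^ 6) (q ^ 6) k)⁻¹
  have hf : Summable f := hT.prod
  have hf₀ : ∀ k, f (2 * k) = (qPochInf (q ^ 3) (q ^ 3))⁻¹ * g k := by
    intro k
    have hk : evenCoeff (q ^ 3) (2 * k) = (qPoch (q ^ 6) (q ^ 6) k)⁻¹ := by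
      rw [evenCoeff_two_mul, ← pow_mul]
    have hs := hT.prod_factor (2 * k)
    simp only [nahmTriple] at hs
    -- Dividing by this nonzero constant gives the summability that the diagonal lemma needs.
    have hne : evenCoeff (q ^ 3) (2 * k) ≠ 0 := by
      rw [hk]
      have hx := norm_pow_lt_one hq (m := 6) (by norm_num)
      exact inv_ne_zero (qPoch_ne_zero hx hx k)
    have hs' := (summable_mul_left_iff hne).mp hs
    have hd := hasSum_diagonal hQ (pow_ne_zero 3 hq0)
      (fun l => q ^ (s * ((2 * k : ℕ) + l) + tri ((2 * k : ℕ) + l))) hs'.hasSum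
    have ht := hd.tsum_eq
    rw [tsum_mul_right] at ht
    simp only [f, g, nahmTriple, nahmTheta]
    rw [tsum_mul_left, ← ht, hk]
    ring
  have hf₁ : ∀ k, f (2 * k + 1) = 0 := by
    intro k
    simp only [f, nahmTriple, evenCoeff_odd, zero_mul, tsum_zero]
  have hc := qPochInf_ne_zero hQ hQ
  have hfe : Summable fun k => f (2 * k) :=
    hf.comp_injective (i := fun j => 2 * j) fun a b h => by simpa using h
  have hg : Summable g := by
    simp only [hf₀] at hfe
    exact (summable_mul_left_iff (inv_ne_zero hc)).mp hfe
  have hge : Summable fun k => g (2 * k) :=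
    hg.comp_injective (i := fun j => 2 * j) fun a b h => by simpa using h
  have hgo : Summable fun k => g (2 * k + 1) :=
    hg.comp_injective (i := fun j => 2 * j + 1) fun a b h => by simpa using h
  have hfo : Summable fun k => f (2 * k + 1) := by
    simp only [hf₁]
    exact summable_zero
  have h₁ : ∑' m, f m = _ := (tsum_even_add_odd hfe hfo).symm
  have h₂ : ∑' m, g m = _ := (tsum_even_add_odd hge hgo).symm
  rw [tsum_nahmTerm_eq_tsum_nahmTriple hq hq0, hT.tsum_prod]
  refine h₁.trans ?_
  simp only [hf₁, tsum_zero, add_zero, hf₀]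
  rw [tsum_mul_left, h₂]

/-- The integer j is the translation that centres the quadratic exponent. -/
theorem nahmTheta_eq {q z c : ℂ} (hq : ‖q‖ < 1) (hq0 : q ≠ 0) (hz : z ≠ 0) {s : ℤ} {k : ℕ} (j : ℤ)
    (h : ∀ l : ℤ, q ^ (s * ((2 * k : ℕ) + l) + tri ((2 * k : ℕ) + l)) * (q ^ 3) ^ tri l =
      c * (z ^ (l + j) * (q ^ 4) ^ tri (l + j))) :
    nahmTheta q s k = c * jacobiProd z (q ^ 4) := by
  have hJ := (hasSum_jacobi (norm_pow_lt_one hq four_ne_zero) (pow_ne_zero 4 hq0) hz).tsum_eq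
  rw [nahmTheta, jacobiProd, ← hJ, ← tsum_mul_left,
    ← (Equiv.addRight j).tsum_eq fun l : ℤ => c * (z ^ l * (q ^ 4) ^ tri l)]
  exact tsum_congr fun l => h l

theorem zpow_exponent_eq {q : ℂ} (hq0 : q ≠ 0) {a b d n : ℤ} {c f : ℕ}
    (h : a + 3 * b = c + (f * n + 4 * d)) :
    q ^ a * (q ^ 3) ^ b = q ^ c * ((q ^ f) ^ n * (q ^ 4) ^ d) := by
  rw [← zpow_natCast q 3, ← zpow_natCast q f, ← zpow_natCast q 4, ← zpow_natCast q c, ← zpow_mul,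
    ← zpow_mul, ← zpow_mul, ← zpow_add₀ hq0, ← zpow_add₀ hq0, ← zpow_add₀ hq0]
  congr 1

theorem tsum_nahmTerm_zero {q : ℂ} (hq : ‖q‖ < 1) (hq0 : q ≠ 0) :
    ∑' p : ℕ × ℕ, nahmTerm q 0 p.1 p.2 = (qPochInf (q ^ 3) (q ^ 3))⁻¹ *
      (jacobiProd (q ^ 0) (q ^ 4) * rogersEven (q ^ 6) 0 +
        q * jacobiProd (q ^ 2) (q ^ 4) * rogersOdd (q ^ 6) 0) := by
  -- With n = l + j, T(4j + l) + 3T(l) = 4T(n) + 6j²: the linear terms cancel.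
  have he : ∀ j : ℕ, nahmTheta q 0 (2 * j) = q ^ (6 * j ^ 2) * jacobiProd (q ^ 0) (q ^ 4) :=
    fun j => nahmTheta_eq hq hq0 (pow_ne_zero _ hq0) j fun l => zpow_exponent_eq hq0 (by
      have h1 := two_mul_tri l
      have h2 := two_mul_tri (l + j)
      have h3 := two_mul_tri ((2 * (2 * j) : ℕ) + l)
      push_cast at h3 ⊢
      linarith)
  -- For odd k the same shift leaves a term 2n, hence z = q².
  have ho : ∀ j : ℕ, nahmTheta q 0 (2 * j + 1) =
      q ^ (6 * j ^ 2 + 6 * j + 1) * jacobiProd (q ^ 2) (q ^ 4) :=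
    fun j => nahmTheta_eq hq hq0 (pow_ne_zero _ hq0) j fun l => zpow_exponent_eq hq0 (by
      have h1 := two_mul_tri l
      have h2 := two_mul_tri (l + j)
      have h3 := two_mul_tri ((2 * (2 * j + 1) : ℕ) + l)
      push_cast at h3 ⊢
      linarith)
  rw [tsum_nahmTerm hq hq0, rogersEven, rogersOdd, ← tsum_mul_left, ← tsum_mul_left]
  congr 3
  · refine funext fun j => ?_
    rw [he, ← pow_mul]
    ring_nf
  · refine funext fun j => ?_
    rw [ho, ← pow_mul]
    ring_nf

theorem tsum_nahmTerm_two {q : ℂ} (hq : ‖q‖ < 1) (hq0 : q ≠ 0) :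
    ∑' p : ℕ × ℕ, nahmTerm q 2 p.1 p.2 = (qPochInf (q ^ 3) (q ^ 3))⁻¹ *
      (jacobiProd (q ^ 2) (q ^ 4) * rogersEven (q ^ 6) 1 +
        q ^ 5 * jacobiProd (q ^ 4) (q ^ 4) * rogersOdd (q ^ 6) 1) := by
  -- Compared with s = 0, the extra exponent 2(2k + l) multiplies z by q².
  have he : ∀ j : ℕ, nahmTheta q 2 (2 * j) =
      q ^ (6 * j ^ 2 + 6 * j) * jacobiProd (q ^ 2) (q ^ 4) :=
    fun j => nahmTheta_eq hq hq0 (pow_ne_zero _ hq0) j fun l => zpow_exponent_eq hq0 (by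
      have h1 := two_mul_tri l
      have h2 := two_mul_tri (l + j)
      have h3 := two_mul_tri ((2 * (2 * j) : ℕ) + l)
      push_cast at h3 ⊢
      linarith)
  have ho : ∀ j : ℕ, nahmTheta q 2 (2 * j + 1) =
      q ^ (6 * j ^ 2 + 12 * j + 5) * jacobiProd (q ^ 4) (q ^ 4) :=
    fun j => nahmTheta_eq hq hq0 (pow_ne_zero _ hq0) j fun l => zpow_exponent_eq hq0 (by
      have h1 := two_mul_tri l
      have h2 := two_mul_tri (l + j)
      have h3 := two_mul_tri ((2 * (2 * j + 1) : ℕ) + l)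
      push_cast at h3 ⊢
      linarith)
  rw [tsum_nahmTerm hq hq0, rogersEven, rogersOdd, ← tsum_mul_left, ← tsum_mul_left]
  congr 3
  · refine funext fun j => ?_
    rw [he, ← pow_mul]
    ring_nf
  · refine funext fun j => ?_
    rw [ho, ← pow_mul]
    ring_nf

theorem nahm_exponent₁ (i j : ℤ) :
    i * (i - 1) / 2 - i * j + 2 * j ^ 2 + 2 * j = tri (i - j) + 3 * tri (j + 1) := by
  have h1 := two_mul_tri i
  have h2 := two_mul_tri (i - j)
  have h3 := two_mul_tri (j + 1)
  rw [← tri_def]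
  linarith

theorem nahm_exponent₂ (i j : ℤ) :
    i * (i + 3) / 2 - i * j + 2 * j ^ 2 = 2 * (i - j) + tri (i - j) + 3 * tri (j + 1) := by
  have h1 := two_mul_tri i
  have h2 := two_mul_tri (i - j)
  have h3 := two_mul_tri (j + 1)
  rw [show i * (i + 3) = i * (i - 1) + 2 * (2 * i) by ring,
    Int.add_mul_ediv_left _ _ two_ne_zero, ← tri_def]
  linarith

theorem nahmTerm₁_eq {q : ℂ} (hq0 : q ≠ 0) (i j : ℕ) : nahmTerm₁ q i j = nahmTerm q 0 i j := by
  rw [nahmTerm₁, nahmTerm, nahm_exponent₁, zpow_add₀ hq0, zpow_mul, zero_mul, zero_add,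
    div_eq_mul_inv, mul_inv]
  norm_cast
  ring

theorem nahmTerm₂_eq {q : ℂ} (hq0 : q ≠ 0) (i j : ℕ) : nahmTerm₂ q i j = nahmTerm q 2 i j := by
  rw [nahmTerm₂, nahmTerm, nahm_exponent₂, zpow_add₀ hq0, zpow_mul q 3, div_eq_mul_inv, mul_inv]
  norm_cast
  ring

/-! ### The case q = 0 and the final assembly -/

theorem qPochInf_zero_left (q : ℂ) : qPochInf 0 q = 1 := by simp [qPochInf]

/-- The exponent T(i - j) + 3T(j + 1) is a sum of nonnegative terms, zero only at (0, 0) and (1, 0),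
where 0 ^ 0 = 1. -/
theorem hasSum_nahmTerm₁_zero : HasSum (fun p : ℕ × ℕ => nahmTerm₁ 0 p.1 p.2) 2 := by
  have h : HasSum (fun p : ℕ × ℕ => nahmTerm₁ 0 p.1 p.2)
      (∑ p ∈ ({(0, 0), (1, 0)} : Finset (ℕ × ℕ)), nahmTerm₁ 0 p.1 p.2) := by
    refine hasSum_sum_of_ne_finset_zero ?_
    rintro ⟨i, j⟩ hp
    simp only [Finset.mem_insert, Finset.mem_singleton, Prod.mk.injEq, not_or] at hp
    rw [nahmTerm₁, nahm_exponent₁, zero_zpow, zero_div]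
    intro h
    have h1 := two_mul_tri ((i : ℤ) - j)
    have h2 := two_mul_tri ((j : ℤ) + 1)
    have h3 : 0 ≤ ((i : ℤ) - j) * ((i : ℤ) - j - 1) := by
      rcases le_or_gt ((i : ℤ) - j) 0 with h | h <;> nlinarith
    have hj : (j : ℤ) = 0 := by nlinarith
    have hj' : j = 0 := by exact_mod_cast hj
    subst hj'
    have hi : (i : ℤ) * (i - 1) = 0 := by
      push_cast at h1 h2 h h3
      nlinarith
    rcases mul_eq_zero.mp hi with h | h <;> omega
  convert h using 1
  rw [Finset.sum_pair (by decide)]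
  simp [nahmTerm₁, qPoch]
  norm_num

theorem hasSum_nahmTerm₂_zero : HasSum (fun p : ℕ × ℕ => nahmTerm₂ 0 p.1 p.2) 1 := by
  have h : HasSum (fun p : ℕ × ℕ => nahmTerm₂ 0 p.1 p.2) (nahmTerm₂ 0 0 0) := by
    refine hasSum_single (0, 0) ?_
    rintro ⟨i, j⟩ hp
    rw [nahmTerm₂, nahm_exponent₂, zero_zpow, zero_div]
    intro h
    have h1 := two_mul_tri ((i : ℤ) - j)
    have h2 := two_mul_tri ((j : ℤ) + 1)
    have hj : (j : ℤ) = 0 := by nlinarith [sq_nonneg ((i : ℤ) - j)]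
    have hi : (i : ℤ) = 0 := by nlinarith [sq_nonneg ((i : ℤ) - j)]
    refine hp ?_
    simp only [Prod.mk.injEq]
    omega
  convert h using 1
  simp [nahmTerm₂, qPoch]

/-- Source of the factors 2 in the theorem: the leading factor is 1 - (-1). -/
theorem qPochInf_neg_one {q : ℂ} (hq : ‖q‖ < 1) : qPochInf (-1) q = 2 * qPochInf (-q) q := by
  rw [qPochInf_eq_one_sub_mul _ hq, neg_one_mul]
  norm_num

theorem jacobiProd_pow_zero_four {q : ℂ} (hq : ‖q‖ < 1) (hq0 : q ≠ 0) :
    jacobiProd (q ^ 0) (q ^ 4) = 2 * qPochInf (-q ^ 4) (q ^ 4) ^ 2 * qPochInf (q ^ 4) (q ^ 4) := by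
  have h : jacobiProd (q ^ 0) (q ^ 4) = _ := jacobiProd_pow hq0 0 4
  rw [h, pow_zero, zero_add, qPochInf_neg_one (norm_pow_lt_one hq four_ne_zero)]
  ring

theorem jacobiProd_pow_two_four {q : ℂ} (hq0 : q ≠ 0) :
    jacobiProd (q ^ 2) (q ^ 4) = qPochInf (-q ^ 2) (q ^ 4) ^ 2 * qPochInf (q ^ 4) (q ^ 4) := by
  have h : jacobiProd (q ^ 2) (q ^ 4) = _ := jacobiProd_pow hq0 2 2
  rw [h]
  ring

theorem jacobiProd_pow_four_four {q : ℂ} (hq : ‖q‖ < 1) (hq0 : q ≠ 0) :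
    jacobiProd (q ^ 4) (q ^ 4) = 2 * qPochInf (-q ^ 4) (q ^ 4) ^ 2 * qPochInf (q ^ 4) (q ^ 4) := by
  have h : jacobiProd (q ^ 4) (q ^ 4) = _ := jacobiProd_pow hq0 4 0
  rw [h, pow_zero, add_zero, qPochInf_neg_one (norm_pow_lt_one hq four_ne_zero)]
  ring

theorem theorem1p3 (q : ℂ) (hq : ‖q‖ < 1) :
    (Summable (fun p : ℕ × ℕ => nahmTerm₁ q p.1 p.2) ∧
      nahmS₁ q =
        qPochInf (q ^ 4) (q ^ 4) /
            (qPochInf (q ^ 3) (q ^ 3) * qPochInf (q ^ 6) (q ^ 12)) *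
          (2 * (qPochInf (-q ^ 4) (q ^ 4) ^ 2 / qPochInf₂ (q ^ 24) (q ^ 96) (q ^ 120)) +
            q * (qPochInf (-q ^ 2) (q ^ 4) ^ 2 /
              qPochInf₂ (q ^ 12) (-q ^ 18) (-q ^ 30)))) ∧
    (Summable (fun p : ℕ × ℕ => nahmTerm₂ q p.1 p.2) ∧
      nahmS₂ q =
        qPochInf (q ^ 4) (q ^ 4) /
            (qPochInf (q ^ 3) (q ^ 3) * qPochInf (q ^ 6) (q ^ 12)) *
          (qPochInf (-q ^ 2) (q ^ 4) ^ 2 / qPochInf₂ (-q ^ 6) (q ^ 24) (-q ^ 30) +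
            2 * q ^ 5 * (qPochInf (-q ^ 4) (q ^ 4) ^ 2 /
              qPochInf₂ (q ^ 48) (q ^ 72) (q ^ 120)))) := by
  -- The manipulations of integer powers need q ≠ 0, so q = 0 is computed directly.
  rcases eq_or_ne q 0 with rfl | hq0
  · refine ⟨⟨hasSum_nahmTerm₁_zero.summable, ?_⟩, ⟨hasSum_nahmTerm₂_zero.summable, ?_⟩⟩
    · rw [nahmS₁, hasSum_nahmTerm₁_zero.tsum_eq]
      simp [qPochInf_zero_left, qPochInf₂]
    · rw [nahmS₂, hasSum_nahmTerm₂_zero.tsum_eq]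
      simp [qPochInf_zero_left, qPochInf₂]
  have hx := norm_pow_lt_one hq (m := 6) (by norm_num)
  have hx0 := pow_ne_zero 6 hq0
  have e₀ := eq_inv_of_mul_eq_one_left (rogersEven_zero hx hx0)
  have o₀ := eq_inv_of_mul_eq_one_left (rogersOdd_zero hx hx0)
  have e₁ := eq_inv_of_mul_eq_one_left (rogersEven_one hx hx0)
  have o₁ := eq_inv_of_mul_eq_one_left (rogersOdd_one hx hx0)
  simp only [← pow_mul, Nat.reduceMul] at e₀ o₀ e₁ o₁
  simp only [nahmS₁, nahmS₂, nahmTerm₁_eq hq0, nahmTerm₂_eq hq0]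
  refine ⟨⟨summable_nahmTerm hq hq0 0, ?_⟩, ⟨summable_nahmTerm hq hq0 2, ?_⟩⟩
  · rw [tsum_nahmTerm_zero hq hq0, e₀, o₀, jacobiProd_pow_zero_four hq hq0,
      jacobiProd_pow_two_four hq0]
    simp only [div_eq_mul_inv, mul_inv]
    ring
  · rw [tsum_nahmTerm_two hq hq0, e₁, o₁, jacobiProd_pow_four_four hq hq0,
      jacobiProd_pow_two_four hq0]
    simp only [div_eq_mul_inv, mul_inv]
    ring
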